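/- All $r$-graphs ($r$-uniform hypergraphs) are finite. For $k\ge r\ge 2$ let $K_k^r$ be the complete $r$-graph on $[k]$. A homomorphism from an $r$-graph $\mathcal H$ to an $r$-graph $\mathcal G$ is a map $\psi:V(\mathcal H)\to V(\mathcal G)$ with $\psi(e)\in\mathcal G$ for all $e\in\mathcal H$; an automorphism is a surjective homomorphism from an $r$-graph to itself. $\mathcal H$ is $k$-partite (equivalently $k$-colorable) if there is a homomorphism from $\mathcal H$ to $K_k^r$; it is uniquely $k$-colorable if it is $k$-colorable and for any two homomorphisms $\psi_1,\psi_2$ from $\mathcal H$ to $K_k^r$ there is an automorphism $\eta$ of $K_k^r$ with $\eta\circ\psi_1=\psi_2$. A vertex is isolated if it lies in no edge. For $1\le i<r$, the degree $d_{\mathcal H}(S)$ of an $i$-set $S$ of vertices is the number of $(r-i)$-sets $e$ with $S\cup e\in\mathcal H$, and the positive minimum $i$-degree $\delta_i^+(\mathcal H)$ is the minimum of $d_{\mathcal H}(S)$ over all $i$-sets $S$ that are contained in an edge of $\mathcal H$. For integers $k\ge r>i\ge 1$ let $\Phi_{k,r,i}$ be the minimum real number such that, for all $n\ge k$, every $n$-vertex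 $k$-partite $r$-graph $\mathcal H$ without isolated vertices and with $\delta_i^+(\mathcal H)>\Phi_{k,r,i}\cdot n^{r-i}$ is uniquely $k$-colorable. **Corollary 1.4.** Let $k\ge r>i\ge 1$ be integers. Then the minimum $\Phi_{k,r,i}$ exists and $$\Phi_{k,r,i}\le\binom{k-i}{r-i}\left(\frac1{k-i}\max\left\{\frac{k-i}{k+2},\ \frac{3k-3i-2}{3k-2}\right\}\right)^{r-i}.$$ In particular, if $k\le\frac{4i+2}{3}$, then $$\Phi_{k,r,i}=\binom{k-i}{r-i}\left(\frac1{k+2}\right)^{r-i}.$$ The lower bound is witnessed by the following $r$-graphs $\mathcal H_{k,r}(1,m)$, $m\ge 1$. The vertex set of $\mathcal H_{k,r}(1,m)$ is the disjoint union of the $m$-element sets $V_1,\dots,V_{k-2},V_{k-1,1},V_{k-1,2},V_{k,1},V_{k,2}$, and for $U_1=V\setminus(V_{k-1,2}\cup V_{k,2})$ and $U_2=V\setminus(V_{k-1,1}\cup V_{k,1})$ its edges are the $r$-sets that are contained in $U_1$ or in $U_2$ and meet each of these $k+2$ sets in at most one vertex. For all $k\ge r>i\ge1$ and $m\ge 1$,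 the $r$-graph $\mathcal H_{k,r}(1,m)$ has $(k+2)m$ vertices, is $k$-partite, has no isolated vertices, is not uniquely $k$-colorable, and satisfies $$\delta_i^+(\mathcal H_{k,r}(1,m))=\binom{k-i}{r-i}\left(\frac1{k+2}\right)^{r-i}\big((k+2)m\big)^{r-i}.$$ -/

import Mathlib

/-- An `r`-graph (an `r`-uniform hypergraph) with vertex set `V`, given by its set of edges. -/
structure RGraph (V : Type*) (r : ℕ) where
  /-- the edges -/
  edges : Finset (Finset V)
  /-- every edge has exactly `r` vertices -/
  card_of_mem : ∀ e ∈ edges, e.card = r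

namespace RGraph

/-- `ψ` is a homomorphism from `H` to `G`: it maps every edge of `H` onto an edge of `G`. -/
def IsHom {V W : Type*} [DecidableEq W] {r : ℕ} (H : RGraph V r) (G : RGraph W r)
    (ψ : V → W) : Prop :=
  ∀ e ∈ H.edges, e.image ψ ∈ G.edges

/-- `η` is an automorphism of `H`: a surjective homomorphism from `H` to itself. -/
def IsAut {V : Type*} [DecidableEq V] {r : ℕ} (H : RGraph V r) (η : V → V) : Prop :=
  Function.Surjective η ∧ H.IsHom H η

/-- The complete `r`-graph `K_k^r` on `k` vertices. -/
def complete (k r : ℕ) : RGraph (Fin k) r where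
  edges := Finset.powersetCard r Finset.univ
  card_of_mem := fun _ he => (Finset.mem_powersetCard.1 he).2

/-- `H` is `k`-colorable (equivalently, `k`-partite): it has a homomorphism to `K_k^r`. -/
def Colorable {V : Type*} {r : ℕ} (H : RGraph V r) (k : ℕ) : Prop :=
  ∃ ψ : V → Fin k, H.IsHom (complete k r) ψ

/-- `H` is uniquely `k`-colorable: it is `k`-colorable, and any two homomorphisms to `K_k^r`
differ by an automorphism of `K_k^r`. -/
def UniquelyColorable {V : Type*} {r : ℕ} (H : RGraph V r) (k : ℕ) : Prop :=
  H.Colorable k ∧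
    ∀ ψ₁ ψ₂ : V → Fin k, H.IsHom (complete k r) ψ₁ → H.IsHom (complete k r) ψ₂ →
      ∃ η : Fin k → Fin k, (complete k r).IsAut η ∧ η ∘ ψ₁ = ψ₂

/-- No vertex is isolated: every vertex lies in an edge. -/
def NoIsolated {V : Type*} {r : ℕ} (H : RGraph V r) : Prop :=
  ∀ v : V, ∃ e ∈ H.edges, v ∈ e

/-- The `j`-th shadow of `H`, the set of `(r - j)`-sets that one gets from the edges by
deleting `j` vertices one after the other. -/
def iterShadow {V : Type*} [DecidableEq V] {r : ℕ} (H : RGraph V r) (j : ℕ) :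
    Finset (Finset V) :=
  Finset.shadow^[j] H.edges

/-- The link of a set `S` of `i` vertices: the members `e` of the `i`-th shadow such that
`S ∪ e` is an edge. -/
def link {V : Type*} [DecidableEq V] {r : ℕ} (H : RGraph V r) (S : Finset V) :
    Finset (Finset V) :=
  (H.iterShadow S.card).filter (fun e => S ∪ e ∈ H.edges)

/-- The degree of a set of vertices: the size of its link. -/
def degree {V : Type*} [DecidableEq V] {r : ℕ} (H : RGraph V r) (S : Finset V) : ℕ :=
  (H.link S).card

/-- The positive minimum `i`-degree: the minimum of the degrees of the members of the
`(r - i)`-th shadow, which are the `i`-sets contained in an edge. -/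
noncomputable def posMinDegree {V : Type*} [DecidableEq V] {r : ℕ} (H : RGraph V r) (i : ℕ) : ℕ :=
  sInf {d : ℕ | ∃ S ∈ H.iterShadow (r - i), H.degree S = d}

end RGraph

/-- The real numbers `c` such that for all `n ≥ k`, every `n`-vertex `k`-partite `r`-graph `H`
without isolated vertices and with positive minimum `i`-degree larger than `c * n ^ (r - i)`
is uniquely `k`-colorable. -/
def colorThresholds (k r i : ℕ) : Set ℝ :=
  {c : ℝ | ∀ (V : Type) [Fintype V] [DecidableEq V] (H : RGraph V r),
    k ≤ Fintype.card V → H.Colorable k → H.NoIsolated →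
    c * (Fintype.card V : ℝ) ^ (r - i) < (H.posMinDegree i : ℝ) →
    H.UniquelyColorable k}

/-- The number `Φ_{k,r,i}`: the minimum of `colorThresholds k r i`. It is written as an
infimum; that it is attained is part of the theorem. -/
noncomputable def colorPhi (k r i : ℕ) : ℝ := sInf (colorThresholds k r i)

/-! The `r`-graph `H_{k,r}(1, m)`. Its vertex set is the disjoint union of `k + 2` sets of size
`m`: the sets `V_j` (index `Sum.inl j`) for the first `k - 2` indices `j`, and the sets `V_{k-1,s}`
(index `Sum.inr (0, s)`) and `V_{k,s}` (index `Sum.inr (1, s)`) for the two values of `s`. -/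

/-- The index set of the `k + 2` parts of `H_{k,r}(1, m)`. -/
abbrev ConstrPart (k : ℕ) : Type := Fin (k - 2) ⊕ (Fin 2 × Fin 2)

/-- The vertex set of `H_{k,r}(1, m)`. -/
abbrev ConstrVertex (k m : ℕ) : Type := ConstrPart k × Fin m

/-- The vertices in the part with index `p`. -/
def constrPartSet (k m : ℕ) (p : ConstrPart k) : Finset (ConstrVertex k m) :=
  Finset.univ.filter (fun v => v.1 = p)

/-- The set `U_s`: all vertices except those of `V_{k-1,t}` and `V_{k,t}` with `t ≠ s`. -/
def constrSide (k m : ℕ) (s : Fin 2) : Finset (ConstrVertex k m) :=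
  Finset.univ.filter (fun v => ∀ c t : Fin 2, v.1 = Sum.inr (c, t) → t = s)

/-- The `r`-graph `H_{k,r}(1, m)`: its edges are the `r`-sets that lie in `U_1` or in `U_2` and
meet every part in at most one vertex. -/
def constrGraph (k r m : ℕ) : RGraph (ConstrVertex k m) r where
  edges := (Finset.powersetCard r Finset.univ).filter (fun e =>
    ∃ s : Fin 2, e ⊆ constrSide k m s ∧ ∀ p : ConstrPart k, (e ∩ constrPartSet k m p).card ≤ 1)
  card_of_mem := fun _ he => (Finset.mem_powersetCard.1 (Finset.mem_filter.1 he).1).2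

/-! Upper bound. Two colorings `ψ₁`, `ψ₂` place each vertex in the cell `(ψ₁ v, ψ₂ v)` of a `k × k`
board. Edges become sets of nonattacking rooks, and their subsets form `colorComplex`. A cell is
weighted by the number of vertices it holds. The colorings differ by a permutation of the colors as
soon as no two occupied cells attack each other. By Maclaurin's inequality
(`sum_prod_powersetCard_le`, `degree_le`) the degree condition forces every `i`-set inside an edge
to have many neighbours. This makes the complex dense (`IsDense`): with total weight `(3k-2)u`,
faces of size `i` have links heavier than `(3k-3i-2)u` and heavier than the fraction `(k-i)/(k+2)`
of the total.

That dense complexes are nonattacking (`IsDense.nonattacking`) is shown by induction on `i`. A cell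
is large if its link weighs more than `(3k-5)u`, so that its nonneighbours, itself included, weigh
less than `3u`. For `i = 1` every cell is large. The link of a small cell is dense for `k-1` and
`i-1`, hence nonattacking by induction.

If all cells are large, a maximal clique has `k` cells, each heavier than `u`. A further cell would
force one more heavy cell, which is large but has three heavy nonneighbours
(`mem_of_large_outside`). If `v` is small, averaging shows that `v` and its neighbours form a full
set of `k` heavy rooks, the star of `v`. When all small cells have the same star, the previous
argument adapts. Otherwise two stars differ: the cells in exactly one of them are small and the
common ones are large, and a linear program in the two average weights is infeasible
(`false_of_two_stars`, `false_of_average_bounds`).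

Lower bound. In `constrGraph` the last two colors can be swapped on one side only, so it has two
essentially different colorings. -/

theorem sum_biUnion_le_sum {α β : Type*} [DecidableEq α] [DecidableEq β] {w : α → ℝ}
    (hw : ∀ c, 0 ≤ w c) (X : Finset β) (f : β → Finset α) :
    ∑ c ∈ X.biUnion f, w c ≤ ∑ v ∈ X, ∑ c ∈ f v, w c := by
  induction X using Finset.induction_on with
  | empty => simp
  | insert a X ha ih =>
    rw [Finset.biUnion_insert, Finset.sum_insert ha]
    have h1 := Finset.sum_union_inter (s₁ := f a) (s₂ := X.biUnion f) (f := w)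
    have h2 : 0 ≤ ∑ c ∈ f a ∩ X.biUnion f, w c := Finset.sum_nonneg (fun c _ => hw c)
    linarith

/-! ### Complexes of nonattacking rooks. -/

/-- A family of sets of mutually nonattacking rooks on a board, closed under taking subsets. -/
structure RookComplex (ι κ : Type*) [DecidableEq ι] [DecidableEq κ] where
  /-- the rows of the board -/
  rows : Finset ι
  /-- the columns of the board -/
  cols : Finset κ
  /-- the faces -/
  faces : Finset (Finset (ι × κ))
  down_closed : ∀ S ∈ faces, ∀ T ⊆ S, T ∈ faces
  subset_board : ∀ S ∈ faces, S ⊆ rows ×ˢ cols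
  row_inj : ∀ S ∈ faces, Set.InjOn Prod.fst (S : Set (ι × κ))
  col_inj : ∀ S ∈ faces, Set.InjOn Prod.snd (S : Set (ι × κ))

/-- Two cells attack each other if they share a row or a column. -/
def Attacks {ι κ : Type*} (x y : ι × κ) : Prop := x.1 = y.1 ∨ x.2 = y.2

theorem Attacks.symm {ι κ : Type*} {x y : ι × κ} (h : Attacks x y) : Attacks y x :=
  h.imp Eq.symm Eq.symm

/-- No two rooks of the set attack each other. -/
def Nonattacking {ι κ : Type*} (S : Finset (ι × κ)) : Prop :=
  ∀ x ∈ S, ∀ y ∈ S, Attacks x y → x = y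

/-- Some subset of prescribed size has at most average weight. -/
theorem exists_subset_card_mul_sum_le {α : Type*} [DecidableEq α] (w : α → ℝ) (m : ℕ)
    (Y : Finset α) (hm : m ≤ Y.card) :
    ∃ Z ⊆ Y, Z.card = m ∧ (Y.card : ℝ) * ∑ c ∈ Z, w c ≤ m * ∑ c ∈ Y, w c := by
  obtain ⟨t, ht⟩ := Nat.exists_eq_add_of_le hm
  induction t generalizing Y with
  | zero => exact ⟨Y, subset_rfl, by omega, by rw [ht]; simp⟩
  | succ t ih =>
    have hne : Y.Nonempty := Finset.card_pos.1 (by omega)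
    obtain ⟨a, ha, hmax⟩ := Finset.exists_max_image Y w hne
    have hc : (Y.erase a).card = m + t := by rw [Finset.card_erase_of_mem ha]; omega
    obtain ⟨Z, hZ, hZm, hle⟩ := ih (Y.erase a) (by omega) hc
    refine ⟨Z, hZ.trans (Finset.erase_subset _ _), hZm, ?_⟩
    have hsum : ∑ c ∈ Y.erase a, w c = ∑ c ∈ Y, w c - w a := by
      rw [← Finset.add_sum_erase Y w ha]; ring
    have hbig : ∑ c ∈ Y, w c ≤ Y.card * w a := by
      simpa using Finset.sum_le_card_nsmul Y w (w a) hmax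
    rw [hc, hsum] at hle
    rcases Nat.eq_zero_or_pos m with h0 | hpos
    · subst h0
      have : Z = ∅ := Finset.card_eq_zero.1 hZm
      simp [this]
    · have hYc : (Y.card : ℝ) = m + t + 1 := by rw [ht]; push_cast; ring
      have hmt : (0 : ℝ) < m + t := by
        have : (0 : ℝ) < m := by exact_mod_cast hpos
        positivity
      push_cast at hle
      rw [hYc] at hbig ⊢
      have h1 : (m + t + 1 : ℝ) * (∑ c ∈ Y, w c - w a) ≤ (m + t) * ∑ c ∈ Y, w c := by linarith
      have h2 := mul_le_mul_of_nonneg_left h1 (Nat.cast_nonneg (α := ℝ) m)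
      have h3 := mul_le_mul_of_nonneg_left hle (by positivity : (0 : ℝ) ≤ m + t + 1)
      refine le_of_mul_le_mul_left ?_ hmt
      linarith

theorem Nonattacking.card_le {ι κ : Type*} {S : Finset (ι × κ)} (h : Nonattacking S) {I : Finset ι}
    {J : Finset κ} (hS : S ⊆ I ×ˢ J) : S.card ≤ I.card :=
  Finset.card_le_card_of_injOn Prod.fst
    (fun _ hx => (Finset.mem_product.1 (hS hx)).1)
    (fun x hx y hy hxy => h x hx y hy (Or.inl hxy))

theorem Nonattacking.exists_row {ι κ : Type*} [DecidableEq ι] {S : Finset (ι × κ)} (h : Nonattacking S) {I : Finset ι}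
    {J : Finset κ} (hS : S ⊆ I ×ˢ J) (hc : I.card ≤ S.card) {a : ι} (ha : a ∈ I) :
    ∃ c ∈ S, c.1 = a := by
  have himg : S.image Prod.fst = I := by
    apply Finset.eq_of_subset_of_card_le
    · intro x hx
      obtain ⟨c, hc, rfl⟩ := Finset.mem_image.1 hx
      exact (Finset.mem_product.1 (hS hc)).1
    · rw [Finset.card_image_of_injOn (fun x hx y hy hxy => h x hx y hy (Or.inl hxy))]
      exact hc
  rw [← himg] at ha
  exact Finset.mem_image.1 ha

theorem Nonattacking.exists_col {ι κ : Type*} [DecidableEq κ] {S : Finset (ι × κ)} (h : Nonattacking S) {I : Finset ι}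
    {J : Finset κ} (hS : S ⊆ I ×ˢ J) (hc : J.card ≤ S.card) {b : κ} (hb : b ∈ J) :
    ∃ c ∈ S, c.2 = b := by
  have himg : S.image Prod.snd = J := by
    apply Finset.eq_of_subset_of_card_le
    · intro x hx
      obtain ⟨c, hc, rfl⟩ := Finset.mem_image.1 hx
      exact (Finset.mem_product.1 (hS hc)).2
    · rw [Finset.card_image_of_injOn (fun x hx y hy hxy => h x hx y hy (Or.inr hxy))]
      exact hc
  rw [← himg] at hb
  exact Finset.mem_image.1 hb

section Board

variable {ι κ : Type*} [DecidableEq ι] [DecidableEq κ]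

namespace RookComplex

variable (Δ : RookComplex ι κ)

/-- The cells that extend the face `S`. -/
def nbrs (S : Finset (ι × κ)) : Finset (ι × κ) :=
  (Δ.rows ×ˢ Δ.cols).filter (fun c => c ∉ S ∧ insert c S ∈ Δ.faces)

variable {Δ}

theorem mem_nbrs {S : Finset (ι × κ)} {c : ι × κ} :
    c ∈ Δ.nbrs S ↔ c ∉ S ∧ insert c S ∈ Δ.faces := by
  unfold nbrs
  rw [Finset.mem_filter, and_iff_right_iff_imp]
  exact fun h => Δ.subset_board _ h.2 (Finset.mem_insert_self _ _)

theorem mem_verts {c : ι × κ} : c ∈ Δ.nbrs ∅ ↔ {c} ∈ Δ.faces := by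
  simp [mem_nbrs]

theorem nbrs_anti {S T : Finset (ι × κ)} (h : S ⊆ T) :
    Δ.nbrs T ⊆ Δ.nbrs S := by
  intro c hc
  rw [mem_nbrs] at hc ⊢
  exact ⟨fun hcS => hc.1 (h hcS), Δ.down_closed _ hc.2 _ (Finset.insert_subset_insert _ h)⟩

theorem mem_nbrs_comm {x y : ι × κ} (h : x ∈ Δ.nbrs {y}) : y ∈ Δ.nbrs {x} := by
  rw [mem_nbrs] at h ⊢
  refine ⟨fun hy => h.1 ?_, ?_⟩
  · rw [Finset.mem_singleton] at hy ⊢; exact hy.symm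
  · rw [Finset.pair_comm]; exact h.2

theorem not_attacks_of_mem_nbrs {x y : ι × κ} (h : x ∈ Δ.nbrs {y}) : ¬ Attacks x y := by
  rw [mem_nbrs] at h
  have hne : x ≠ y := fun he => h.1 (by simp [he])
  rintro (h1 | h1)
  · exact hne (Δ.row_inj _ h.2 (by simp) (by simp) h1)
  · exact hne (Δ.col_inj _ h.2 (by simp) (by simp) h1)

theorem verts_subset_board : Δ.nbrs ∅ ⊆ Δ.rows ×ˢ Δ.cols := Finset.filter_subset _ _

/-- Every face below a given size can be extended, and the faces of size `i` have many
extensions: `Δ` carries total weight `(3 * k - 2) * u`. -/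
structure IsDense (Δ : RookComplex ι κ) (w : ι × κ → ℝ) (u : ℝ) (k i : ℕ) : Prop where
  nonneg : ∀ c, 0 ≤ w c
  one_le : 1 ≤ i
  lt : i < k
  card_rows : Δ.rows.card = k
  card_cols : Δ.cols.card = k
  extend : ∀ S ∈ Δ.faces, S.card < i → (Δ.nbrs S).Nonempty
  total : ∑ c ∈ Δ.nbrs ∅, w c = (3 * k - 2) * u
  bound₁ : ∀ S ∈ Δ.faces, S.card = i → (3 * k - 3 * i - 2) * u < ∑ c ∈ Δ.nbrs S, w c
  bound₂ : ∀ S ∈ Δ.faces, S.card = i →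
    ((k : ℝ) - i) * ((3 * k - 2) * u) < (k + 2) * ∑ c ∈ Δ.nbrs S, w c

/-- The vertex `v` has few non-neighbours. -/
def IsLarge (Δ : RookComplex ι κ) (w : ι × κ → ℝ) (u : ℝ) (k : ℕ) (v : ι × κ) : Prop :=
  (3 * k - 5) * u < ∑ c ∈ Δ.nbrs {v}, w c

/-- A maximal face between `S₀` and `S₀ ∪ X` has no extension inside `X`, and enlarging it to size
`i` only shrinks its set of neighbours. Thus the density bounds apply to the neighbours of `S₀`
outside `X`, although `S₀ ∪ X` need not be a face. -/
theorem exists_face_nbrs_subset {i : ℕ}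
    (hext : ∀ S ∈ Δ.faces, S.card < i → (Δ.nbrs S).Nonempty)
    {S₀ X : Finset (ι × κ)} (hS₀ : S₀ ∈ Δ.faces) (hX : S₀.card + X.card ≤ i) :
    ∃ S ∈ Δ.faces, S.card = i ∧ Δ.nbrs S ⊆ Δ.nbrs S₀ \ X := by
  have grow : ∀ t : ℕ, ∀ S ∈ Δ.faces, S.card + t = i →
      ∃ T ∈ Δ.faces, T.card = i ∧ S ⊆ T := by
    intro t
    induction t with
    | zero => exact fun S hS h => ⟨S, hS, by omega, subset_rfl⟩
    | succ t ih =>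
      intro S hS h
      obtain ⟨c, hc⟩ := hext S hS (by omega)
      rw [mem_nbrs] at hc
      obtain ⟨T, hT, hTi, hsub⟩ := ih _ hc.2 (by rw [Finset.card_insert_of_notMem hc.1]; omega)
      exact ⟨T, hT, hTi, (Finset.subset_insert _ _).trans hsub⟩
  obtain ⟨S, hS, hmax⟩ := Finset.exists_max_image
    (Δ.faces.filter (fun S => S₀ ⊆ S ∧ S ⊆ S₀ ∪ X)) Finset.card
    ⟨S₀, by simp [hS₀]⟩
  rw [Finset.mem_filter] at hS
  have hcard : S.card ≤ i :=
    (Finset.card_le_card hS.2.2).trans ((Finset.card_union_le _ _).trans hX)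
  obtain ⟨T, hT, hTi, hsub⟩ := grow (i - S.card) S hS.1 (by omega)
  refine ⟨T, hT, hTi, fun c hc => ?_⟩
  have hcS := nbrs_anti hsub hc
  refine Finset.mem_sdiff.2 ⟨nbrs_anti hS.2.1 hcS, fun hcX => ?_⟩
  rw [mem_nbrs] at hcS
  have := hmax (insert c S) (Finset.mem_filter.2 ⟨hcS.2, hS.2.1.trans (Finset.subset_insert _ _),
    Finset.insert_subset (Finset.mem_union_right _ hcX) hS.2.2⟩)
  rw [Finset.card_insert_of_notMem hcS.1] at this
  omega

end RookComplex

end Board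

/-! ### Dense complexes: large cells, heavy cells and covering. -/

section Board

variable {ι κ : Type*} [DecidableEq ι] [DecidableEq κ]

namespace RookComplex

variable {Δ : RookComplex ι κ}

namespace IsDense

variable {w : ι × κ → ℝ} {u : ℝ} {k i : ℕ}

theorem sum_mono (h : Δ.IsDense w u k i) {X Y : Finset (ι × κ)} (hXY : X ⊆ Y) :
    ∑ c ∈ X, w c ≤ ∑ c ∈ Y, w c :=
  Finset.sum_le_sum_of_subset_of_nonneg hXY (fun c _ _ => h.nonneg c)

theorem sum_nonneg (h : Δ.IsDense w u k i) (X : Finset (ι × κ)) : 0 ≤ ∑ c ∈ X, w c :=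
  Finset.sum_nonneg (fun c _ => h.nonneg c)

theorem two_le (h : Δ.IsDense w u k i) : (2 : ℝ) ≤ k := by
  have := h.one_le
  have := h.lt
  exact_mod_cast (by omega : 2 ≤ k)

theorem unit_nonneg (h : Δ.IsDense w u k i) : 0 ≤ u := by
  have h2 := h.two_le
  have := h.sum_nonneg (Δ.nbrs ∅)
  rw [h.total] at this
  exact nonneg_of_mul_nonneg_right this (by linarith)

theorem bound₁_sdiff (h : Δ.IsDense w u k i) {S₀ X : Finset (ι × κ)} (hS₀ : S₀ ∈ Δ.faces)
    (hX : S₀.card + X.card ≤ i) :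
    (3 * k - 3 * i - 2) * u < ∑ c ∈ Δ.nbrs S₀ \ X, w c := by
  obtain ⟨S, hS, hi, hsub⟩ := exists_face_nbrs_subset h.extend hS₀ hX
  exact (h.bound₁ S hS hi).trans_le (h.sum_mono hsub)

theorem bound₂_sdiff (h : Δ.IsDense w u k i) {S₀ X : Finset (ι × κ)} (hS₀ : S₀ ∈ Δ.faces)
    (hX : S₀.card + X.card ≤ i) :
    ((k : ℝ) - i) * ((3 * k - 2) * u) < (k + 2) * ∑ c ∈ Δ.nbrs S₀ \ X, w c := by
  obtain ⟨S, hS, hi, hsub⟩ := exists_face_nbrs_subset h.extend hS₀ hX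
  refine (h.bound₂ S hS hi).trans_le ?_
  have := h.sum_mono hsub
  have := h.two_le
  gcongr

theorem sdiff_nonempty (h : Δ.IsDense w u k i) {S₀ X : Finset (ι × κ)} (hS₀ : S₀ ∈ Δ.faces)
    (hX : S₀.card + X.card ≤ i) : (Δ.nbrs S₀ \ X).Nonempty := by
  by_contra hne
  rw [Finset.not_nonempty_iff_eq_empty] at hne
  have h1 := h.bound₁_sdiff hS₀ hX
  rw [hne, Finset.sum_empty] at h1
  have : (i : ℝ) + 1 ≤ k := by exact_mod_cast h.lt
  have := mul_nonneg (by linarith : (0 : ℝ) ≤ 3 * k - 3 * i - 2) h.unit_nonneg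
  linarith

theorem unit_pos (h : Δ.IsDense w u k i) {S : Finset (ι × κ)} (hS : S ∈ Δ.faces) : 0 < u := by
  have h0 : ∅ ∈ Δ.faces := Δ.down_closed _ hS _ (Finset.empty_subset _)
  have h1 := h.bound₁_sdiff (X := ∅) h0 (by simp)
  rcases h.unit_nonneg.lt_or_eq with hu | hu
  · exact hu
  · rw [Finset.sdiff_empty, h.total, ← hu] at h1
    simp at h1

/-- A set of vertices that avoids the neighbours of a large vertex is light. -/
theorem sum_lt_of_isLarge (h : Δ.IsDense w u k i) {v : ι × κ} (hv : Δ.IsLarge w u k v)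
    {X : Finset (ι × κ)} (hX : X ⊆ Δ.nbrs ∅) (hd : Disjoint X (Δ.nbrs {v})) :
    ∑ c ∈ X, w c < 3 * u := by
  have hsub : X ∪ Δ.nbrs {v} ⊆ Δ.nbrs ∅ :=
    Finset.union_subset hX (nbrs_anti (Finset.empty_subset _))
  have := h.sum_mono hsub
  rw [Finset.sum_union hd, h.total] at this
  unfold IsLarge at hv
  linarith

/-- Two heavy nonneighbours, together with one more heavy cell, are too many for a
large vertex. -/
theorem three_heavy (h : Δ.IsDense w u k i) {v x y z : ι × κ} (hv : Δ.IsLarge w u k v)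
    (hxy : x ≠ y) (hxz : x ≠ z) (hyz : y ≠ z)
    (hx : x ∈ Δ.nbrs ∅) (hy : y ∈ Δ.nbrs ∅) (hz : z ∈ Δ.nbrs ∅)
    (hvx : x ∉ Δ.nbrs {v}) (hvy : y ∉ Δ.nbrs {v}) (hvz : z ∉ Δ.nbrs {v})
    (hwx : u < w x) (hwy : u < w y) (hwz : u < w z) : False := by
  have := h.sum_lt_of_isLarge hv (X := {x, y, z})
    (by intro c; simp only [Finset.mem_insert, Finset.mem_singleton]; rintro (rfl | rfl | rfl) <;> assumption)
    (by
      rw [Finset.disjoint_left]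
      intro c; simp only [Finset.mem_insert, Finset.mem_singleton]; rintro (rfl | rfl | rfl) <;> assumption)
  rw [Finset.sum_insert (by simp [hxy, hxz]), Finset.sum_insert (by simp [hyz]),
    Finset.sum_singleton] at this
  linarith

/-- If all vertices outside `R` are nonneighbours of one of the large vertices in `X`, then
`R` is heavy. -/
theorem lt_sum_of_cover (h : Δ.IsDense w u k i) {X R : Finset (ι × κ)} (hne : X.Nonempty)
    (hX : ∀ v ∈ X, Δ.IsLarge w u k v)
    (hcov : ∀ x ∈ Δ.nbrs ∅, x ∉ R → ∃ v ∈ X, x ∉ Δ.nbrs {v}) :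
    (3 * k - 2) * u < 3 * X.card * u + ∑ c ∈ R, w c := by
  have hsub : Δ.nbrs ∅ ⊆ X.biUnion (fun v => Δ.nbrs ∅ \ Δ.nbrs {v}) ∪ R := by
    intro x hx
    by_cases hxR : x ∈ R
    · exact Finset.mem_union_right _ hxR
    · obtain ⟨v, hv, hxv⟩ := hcov x hx hxR
      exact Finset.mem_union_left _ (Finset.mem_biUnion.2 ⟨v, hv, Finset.mem_sdiff.2 ⟨hx, hxv⟩⟩)
  have h1 := h.sum_mono hsub
  rw [h.total] at h1
  have h2 : ∑ c ∈ X.biUnion (fun v => Δ.nbrs ∅ \ Δ.nbrs {v}) ∪ R, w c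
      ≤ ∑ c ∈ X.biUnion (fun v => Δ.nbrs ∅ \ Δ.nbrs {v}), w c + ∑ c ∈ R, w c := by
    rw [← Finset.sum_union_inter]
    linarith [h.sum_nonneg (X.biUnion (fun v => Δ.nbrs ∅ \ Δ.nbrs {v}) ∩ R)]
  have h3 : ∑ c ∈ X.biUnion (fun v => Δ.nbrs ∅ \ Δ.nbrs {v}), w c
      ≤ ∑ v ∈ X, ∑ c ∈ Δ.nbrs ∅ \ Δ.nbrs {v}, w c :=
    sum_biUnion_le_sum h.nonneg _ _
  have h4 : ∑ v ∈ X, ∑ c ∈ Δ.nbrs ∅ \ Δ.nbrs {v}, w c < ∑ v ∈ X, 3 * u :=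
    Finset.sum_lt_sum_of_nonempty hne (fun v hv =>
      h.sum_lt_of_isLarge (hX v hv) Finset.sdiff_subset Finset.sdiff_disjoint)
  rw [Finset.sum_const, nsmul_eq_mul] at h4
  linarith

/-- A vertex of a full set of nonattacking rooks is heavy if all the others are large. -/
theorem heavy_of_others_large (h : Δ.IsDense w u k i) {σ : Finset (ι × κ)} {v : ι × κ}
    (hσ : Nonattacking σ) (hsub : σ ⊆ Δ.nbrs ∅) (hcard : σ.card = k) (hv : v ∈ σ)
    (hl : ∀ c ∈ σ, c ≠ v → Δ.IsLarge w u k c) : u < w v := by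
  have hk := h.two_le
  have hk' : 2 ≤ k := by exact_mod_cast hk
  have hb := hsub.trans verts_subset_board
  have hce : (σ.erase v).card = k - 1 := by rw [Finset.card_erase_of_mem hv, hcard]
  have := h.lt_sum_of_cover (X := σ.erase v) (R := {v}) (Finset.card_pos.1 (by omega))
    (fun c hc => hl c (Finset.mem_of_mem_erase hc) (Finset.ne_of_mem_erase hc))
    -- The rooks of `σ` in the row and in the column of `x` cannot both be `v` unless `x = v`, so
    -- one of the others attacks `x`.
    (fun x hx hxv => by
      have hxb := Finset.mem_product.1 (verts_subset_board hx)
      obtain ⟨a, ha, hax⟩ := hσ.exists_row hb (by rw [h.card_rows, hcard]) hxb.1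
      obtain ⟨b, hb, hbx⟩ := hσ.exists_col hb (by rw [h.card_cols, hcard]) hxb.2
      by_cases hav : a = v
      · by_cases hbv : b = v
        · exact absurd (Finset.mem_singleton.2
            (Prod.ext (by rw [← hax, hav]) (by rw [← hbx, hbv]))) hxv
        · exact ⟨b, Finset.mem_erase.2 ⟨hbv, hb⟩,
            fun hc => not_attacks_of_mem_nbrs hc (Or.inr hbx.symm)⟩
      · exact ⟨a, Finset.mem_erase.2 ⟨hav, ha⟩,
            fun hc => not_attacks_of_mem_nbrs hc (Or.inl hax.symm)⟩)
  rw [hce, Finset.sum_singleton, Nat.cast_sub (by omega)] at this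
  push_cast at this
  linarith

/-- A full set of heavy nonattacking rooks contains all vertices, provided that the vertices
outside are large, and so are those inside that such a vertex does not attack. -/
theorem mem_of_large_outside (h : Δ.IsDense w u k i) {σ : Finset (ι × κ)}
    (hσ : Nonattacking σ) (hsub : σ ⊆ Δ.nbrs ∅) (hcard : σ.card = k)
    (hheavy : ∀ c ∈ σ, u < w c)
    (hout : ∀ z ∈ Δ.nbrs ∅, z ∉ σ → Δ.IsLarge w u k z)
    (hin : ∀ z ∈ Δ.nbrs ∅, z ∉ σ → ∀ c ∈ σ, ¬ Attacks z c → Δ.IsLarge w u k c)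
    {z : ι × κ} (hz : z ∈ Δ.nbrs ∅) : z ∈ σ := by
  by_contra hzσ
  have hk := h.two_le
  have hk' : 2 ≤ k := by exact_mod_cast hk
  have hb := hsub.trans verts_subset_board
  have hrow : ∀ x ∈ Δ.nbrs ∅, ∃ a ∈ σ, a.1 = x.1 := fun x hx =>
    hσ.exists_row hb (by rw [h.card_rows, hcard]) (Finset.mem_product.1 (verts_subset_board hx)).1
  have hcol : ∀ x ∈ Δ.nbrs ∅, ∃ a ∈ σ, a.2 = x.2 := fun x hx =>
    hσ.exists_col hb (by rw [h.card_cols, hcard]) (Finset.mem_product.1 (verts_subset_board hx)).2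
  obtain ⟨a, ha, haz⟩ := hrow z hz
  obtain ⟨b, hbσ, hbz⟩ := hcol z hz
  have hab : a ≠ b := by
    rintro rfl
    exact hzσ (by rwa [← Prod.ext haz hbz])
  have hX : ((σ.erase a).erase b).card = k - 2 := by
    rw [Finset.card_erase_of_mem (Finset.mem_erase.2 ⟨hab.symm, hbσ⟩),
      Finset.card_erase_of_mem ha, hcard]; omega
  have hzX : z ∉ (σ.erase a).erase b := fun hc =>
    hzσ (Finset.mem_of_mem_erase (Finset.mem_of_mem_erase hc))
  have hnatt : ∀ c ∈ σ, c ≠ a → c ≠ b → ¬ Attacks z c := by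
    rintro c hc hca hcb (h1 | h1)
    · exact hca (hσ c hc a ha (Or.inl (h1.symm.trans haz.symm)))
    · exact hcb (hσ c hc b hbσ (Or.inr (h1.symm.trans hbz.symm)))
  -- Replacing `a` and `b` by `z` leaves `k - 1` large rooks. The only cell they do not attack is
  -- the crossing of the row of `b` with the column of `a`, so this cell must be a vertex of weight
  -- more than `u`.
  have hcover := h.lt_sum_of_cover (X := insert z ((σ.erase a).erase b))
    (R := {(b.1, a.2)} ∩ Δ.nbrs ∅)
    (Finset.insert_nonempty _ _)
    (by
      intro c hc
      rcases Finset.mem_insert.1 hc with rfl | hc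
      · exact hout _ hz hzσ
      · rw [Finset.mem_erase, Finset.mem_erase] at hc
        exact hin z hz hzσ c hc.2.2 (hnatt c hc.2.2 hc.2.1 hc.1))
    (by
      intro x hx hxR
      by_contra hcon
      push Not at hcon
      have hxz := not_attacks_of_mem_nbrs (hcon z (Finset.mem_insert_self _ _))
      have hxc : ∀ c ∈ σ, c ≠ a → c ≠ b → ¬ Attacks x c := fun c hc hca hcb =>
        not_attacks_of_mem_nbrs (hcon c (by simp [hc, hca, hcb]))
      obtain ⟨c, hc, hcx⟩ := hrow x hx
      obtain ⟨d, hd, hdx⟩ := hcol x hx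
      have hcb : c = b := by
        by_contra hcb
        by_cases hca : c = a
        · exact hxz (Or.inl (by rw [← hcx, hca, haz]))
        · exact hxc c hc hca hcb (Or.inl hcx.symm)
      have hda : d = a := by
        by_contra hda
        by_cases hdb : d = b
        · exact hxz (Or.inr (by rw [← hdx, hdb, hbz]))
        · exact hxc d hd hda hdb (Or.inr hdx.symm)
      refine hxR (Finset.mem_inter.2 ⟨Finset.mem_singleton.2 (Prod.ext ?_ ?_), hx⟩)
      · rw [← hcx, hcb]
      · rw [← hdx, hda])
  rw [Finset.card_insert_of_notMem hzX, hX] at hcover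
  have hcast : ((k - 2 + 1 : ℕ) : ℝ) = k - 1 := by
    rw [show k - 2 + 1 = k - 1 by omega, Nat.cast_sub (by omega)]; simp
  rw [hcast] at hcover
  have hu : 0 < u := h.unit_pos (mem_verts.1 hz)
  have hmem : (b.1, a.2) ∈ Δ.nbrs ∅ := by
    by_contra hm
    rw [Finset.singleton_inter_of_notMem hm, Finset.sum_empty] at hcover
    linarith
  rw [Finset.singleton_inter_of_mem hmem, Finset.sum_singleton] at hcover
  have hne1 : (b.1, a.2) ≠ a := by
    intro he
    exact hab (hσ a ha b hbσ (Or.inl (by rw [← he])))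
  have hne2 : (b.1, a.2) ≠ b := by
    intro he
    exact hab (hσ a ha b hbσ (Or.inr (by rw [← he])))
  have hnot : (b.1, a.2) ∉ σ := fun hm => hne1 (hσ _ hm a ha (Or.inr rfl))
  -- The crossing cell is itself large, and its nonneighbours include the three heavy cells formed
  -- by itself, `a` and `b`.
  exact h.three_heavy (hout _ hmem hnot) hne1 hne2 hab hmem (hsub ha) (hsub hbσ)
    (fun hc => not_attacks_of_mem_nbrs hc (Or.inl rfl))
    (fun hc => not_attacks_of_mem_nbrs hc (Or.inr rfl))
    (fun hc => not_attacks_of_mem_nbrs hc (Or.inl rfl))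
    (by linarith) (hheavy a ha) (hheavy b hbσ)

/-- If all vertices are large, then no two vertices attack each other. -/
theorem nonattacking_of_all_large (h : Δ.IsDense w u k i)
    (hl : ∀ v ∈ Δ.nbrs ∅, Δ.IsLarge w u k v) : Nonattacking (Δ.nbrs ∅) := by
  rcases (Δ.nbrs ∅).eq_empty_or_nonempty with hemp | ⟨v₀, hv₀⟩
  · rw [hemp]; intro x hx; simp at hx
  have hu : 0 < u := h.unit_pos (mem_verts.1 hv₀)
  -- A maximum clique of the adjacency graph; it need not be a face. By maximality every vertex is a
  -- nonneighbour of a member, which gives `3k - 2 < 3|σ|` and hence `|σ| ≥ k` by integrality.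
  obtain ⟨σ, hσ, hmax⟩ := Finset.exists_max_image
    ((Δ.nbrs ∅).powerset.filter (fun σ => ∀ x ∈ σ, ∀ y ∈ σ, x ≠ y → x ∈ Δ.nbrs {y})) Finset.card
    ⟨{v₀}, by
      rw [Finset.mem_filter, Finset.mem_powerset]
      refine ⟨by simpa using hv₀, ?_⟩
      intro x hx y hy hne
      rw [Finset.mem_singleton] at hx hy
      exact absurd (hx.trans hy.symm) hne⟩
  rw [Finset.mem_filter, Finset.mem_powerset] at hσ
  have hna : Nonattacking σ := by
    intro x hx y hy hxy
    by_contra hne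
    exact not_attacks_of_mem_nbrs (hσ.2 x hx y hy hne) hxy
  have hle : σ.card ≤ k := by
    have := hna.card_le (hσ.1.trans verts_subset_board)
    rwa [h.card_rows] at this
  have hcov := h.lt_sum_of_cover (X := σ) (R := ∅)
    (by
      have := hmax {v₀} (by
        rw [Finset.mem_filter, Finset.mem_powerset]
        refine ⟨by simpa using hv₀, ?_⟩
        intro x hx y hy hne
        rw [Finset.mem_singleton] at hx hy
        exact absurd (hx.trans hy.symm) hne)
      rw [Finset.card_singleton] at this
      exact Finset.card_pos.1 (by omega))
    (fun v hv => hl v (hσ.1 hv))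
    (by
      intro x hx _
      by_contra hcon
      push Not at hcon
      have hxσ : x ∉ σ := fun hxσ => (mem_nbrs.1 (hcon x hxσ)).1 (by simp)
      have := hmax (insert x σ) (by
        rw [Finset.mem_filter, Finset.mem_powerset]
        refine ⟨Finset.insert_subset hx hσ.1, ?_⟩
        intro a ha b hb hab
        rcases Finset.mem_insert.1 ha with rfl | ha'
        · rcases Finset.mem_insert.1 hb with rfl | hb'
          · exact absurd rfl hab
          · exact hcon b hb'
        · rcases Finset.mem_insert.1 hb with rfl | hb'
          · exact mem_nbrs_comm (hcon a ha')
          · exact hσ.2 a ha' b hb' hab)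
      rw [Finset.card_insert_of_notMem hxσ] at this
      omega)
  rw [Finset.sum_empty, add_zero] at hcov
  have hge : k ≤ σ.card := by
    have h1 : (3 * k - 2 : ℝ) < 3 * σ.card := lt_of_mul_lt_mul_right hcov hu.le
    have h2 : (3 * k : ℝ) < 3 * σ.card + 2 := by linarith
    have h3 : 3 * k < 3 * σ.card + 2 := by exact_mod_cast h2
    omega
  have hcard : σ.card = k := le_antisymm hle hge
  have hall : Δ.nbrs ∅ ⊆ σ := fun z hz => h.mem_of_large_outside hna hσ.1 hcard
    (fun c hc => h.heavy_of_others_large hna hσ.1 hcard hc (fun d hd _ => hl d (hσ.1 hd)))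
    (fun z hz _ => hl z hz) (fun _ _ _ c hc _ => hl c (hσ.1 hc)) hz
  intro x hx y hy
  exact hna x (hall hx) y (hall hy)

end IsDense

end RookComplex

end Board

/-! ### The linear program for two stars. -/

/-- The linear program behind `RookComplex.IsDense.false_of_two_stars`. -/
theorem false_of_average_bounds {k i d : ℕ} {u P s : ℝ} (hi : 1 ≤ i) (hik : i < k)
    (hd : 2 ≤ d) (hdk : d ≤ k) (hu : 0 < u) (hs : s ≤ 3 * u)
    (htot : 2 * d * P + (k - d) * s ≤ (3 * k - 2) * u)
    (hlin : ∀ j l : ℕ, j < d → l ≤ k - d → j + l = k - i →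
      (3 * k - 3 * i - 2) * u < j * P + l * s ∧
      ((k : ℝ) - i) * ((3 * k - 2) * u) < (k + 2) * (j * P + l * s)) : False := by
  obtain ⟨q, rfl⟩ := Nat.exists_eq_add_of_lt hik
  have hd' : (2 : ℝ) ≤ d := by exact_mod_cast hd
  have hi' : (1 : ℝ) ≤ i := by exact_mod_cast hi
  have hdk' : (d : ℝ) ≤ i + q + 1 := by exact_mod_cast hdk
  have hq0 : (0 : ℝ) ≤ q := Nat.cast_nonneg q
  push_cast at htot hlin
  -- With `k = i + q + 1`, the lower bound with factor `k + 2` contradicts any upper bound with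
  -- factor `k + d`, because `d ≥ 2`. All cases but the last exhibit such an `A = jP + ls`, choosing
  -- `j` and `l` to favour the lighter kind of cell.
  have key : ∀ A : ℝ, (q + 1 : ℝ) * ((3 * (i + q + 1) - 2) * u) < (i + q + 1 + 2) * A →
      (i + q + 1 + d) * A ≤ (q + 1 : ℝ) * ((3 * (i + q + 1) - 2) * u) → False := by
    intro A h1 h2
    have h3 : 0 < (i + q + 1 + 2) * A := by
      refine lt_of_le_of_lt ?_ h1
      have : (0 : ℝ) ≤ 3 * (i + q + 1) - 2 := by linarith
      positivity
    have hA : 0 < A := pos_of_mul_pos_right h3 (by positivity)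
    nlinarith
  rcases le_or_gt s P with hsP | hsP
  · rcases le_or_gt d i with hdi | hdi
    · have h1 := (hlin 0 (q + 1) (by omega) (by omega) (by omega)).2
      push_cast at h1
      refine key ((q + 1) * s) (by linarith) ?_
      have : (i + q + 1 + d) * s ≤ 2 * d * P + (i + q + 1 - d) * s := by nlinarith
      nlinarith
    · have h1 := (hlin (d - i) (i + q + 1 - d) (by omega) (by omega) (by omega)).2
      rw [Nat.cast_sub hdi.le, Nat.cast_sub hdk] at h1
      push_cast at h1
      refine key (((d : ℝ) - i) * P + (i + q + 1 - d) * s) (by linarith) ?_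
      have hA : ((d : ℝ) - i) * P + (i + q + 1 - d) * s ≤ (q + 1) * P := by nlinarith
      have h2 : ((d : ℝ) + i) * (((d : ℝ) - i) * P + (i + q + 1 - d) * s)
          ≤ (d + i) * ((q + 1) * P) := by gcongr
      nlinarith
  · rcases lt_or_ge (q + 1) d with hqd | hqd
    · have h1 := (hlin (q + 1) 0 hqd (by omega) (by omega)).2
      push_cast at h1
      refine key ((q + 1) * P) (by linarith) ?_
      have : (i + q + 1 + d) * P ≤ 2 * d * P + (i + q + 1 - d) * s := by nlinarith
      nlinarith
    · obtain ⟨h1, h2⟩ := hlin (d - 1) (q + 1 - (d - 1)) (by omega) (by omega) (by omega)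
      rw [Nat.cast_sub (by omega), Nat.cast_sub (by omega : d - 1 ≤ q + 1),
        Nat.cast_sub (by omega)] at h1 h2
      push_cast at h1 h2
      set A : ℝ := ((d : ℝ) - 1) * P + (q + 1 - (d - 1)) * s with hA
      -- `B` is the coefficient of `s` left over when `(d - 1)` times the total is written in terms
      -- of `2dA`. For `B ≥ 0` use `A ≤ (k - i)s` and the relative bound; for `B < 0` use `s ≤ 3u`
      -- and the absolute bound.
      set B : ℝ := ((d : ℝ) - 1) * (i + q + 1 - d) - 2 * d * (q + 1 - (d - 1)) with hB
      have htot' : 2 * d * A + B * s ≤ (d - 1) * ((3 * (i + q + 1) - 2) * u) := by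
        have := mul_le_mul_of_nonneg_left htot (by linarith : (0 : ℝ) ≤ d - 1)
        rw [hA, hB]
        linarith
      have hAs : A ≤ (q + 1) * s := by
        have := mul_le_mul_of_nonneg_left hsP.le (by linarith : (0 : ℝ) ≤ d - 1)
        rw [hA]; linarith
      rcases le_or_gt 0 B with hB0 | hB0
      · refine key A (by linarith) ?_
        have h3 := mul_le_mul_of_nonneg_left hAs hB0
        have h4 := mul_le_mul_of_nonneg_left htot' (by linarith : (0 : ℝ) ≤ q + 1)
        have h5 : (d - 1 : ℝ) * ((i + q + 1 + d) * A)
            ≤ (d - 1) * ((q + 1) * ((3 * (i + q + 1) - 2) * u)) := by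
          have : (d - 1 : ℝ) * ((i + q + 1 + d) * A) = (q + 1) * (2 * d * A) + B * A := by
            rw [hB]; ring
          rw [this]
          linarith
        exact le_of_mul_le_mul_left h5 (by linarith)
      · have h3 := mul_le_mul_of_nonpos_left hs hB0.le
        have h4 : 2 * d * ((3 * (i + q + 1) - 3 * i - 2) * u) < 2 * d * A := by gcongr
        have h5 : 0 ≤ (3 * d + 1) * (d - 2) * u := by
          have : (0 : ℝ) ≤ d - 2 := by linarith
          positivity
        rw [hB] at h3
        rw [hB] at htot'
        linarith

theorem card_mul_le_sum_of_lt {α : Type*} {w : α → ℝ} {u : ℝ} (X : Finset α)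
    (hX : ∀ c ∈ X, u < w c) : X.card * u ≤ ∑ c ∈ X, w c := by
  simpa using Finset.card_nsmul_le_sum X w u (fun c hc => (hX c hc).le)

/-! ### Stars of small vertices. -/

section Board

variable {ι κ : Type*} [DecidableEq ι] [DecidableEq κ]

/-- Two different full sets of nonattacking rooks differ in at least two cells. -/
theorem Nonattacking.two_le_card_sdiff {σ τ : Finset (ι × κ)} (hσ : Nonattacking σ)
    (hτ : Nonattacking τ) {I : Finset ι} {J : Finset κ} (hσb : σ ⊆ I ×ˢ J) (hτb : τ ⊆ I ×ˢ J)
    (hI : I.card = τ.card) (hJ : J.card = τ.card) (hc : σ.card = τ.card) (hne : σ ≠ τ) :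
    2 ≤ (τ \ σ).card := by
  obtain ⟨c, hcσ, hcτ⟩ : ∃ c ∈ σ, c ∉ τ := by
    by_contra hcon
    push Not at hcon
    exact hne (Finset.eq_of_subset_of_card_le hcon hc.ge)
  have hcb := Finset.mem_product.1 (hσb hcσ)
  obtain ⟨a, ha, hac⟩ := hτ.exists_row hτb hI.le hcb.1
  obtain ⟨b, hb, hbc⟩ := hτ.exists_col hτb hJ.le hcb.2
  have haσ : a ∉ σ := fun h => hcτ (by rwa [← hσ a h c hcσ (Or.inl hac)])
  have hbσ : b ∉ σ := fun h => hcτ (by rwa [← hσ b h c hcσ (Or.inr hbc)])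
  have hab : a ≠ b := by
    rintro rfl
    exact hcτ (by rwa [← Prod.ext hac hbc])
  rw [← Finset.card_pair hab]
  refine Finset.card_le_card (fun x hx => ?_)
  simp only [Finset.mem_insert, Finset.mem_singleton] at hx
  rcases hx with rfl | rfl <;> simp [*]

namespace RookComplex

variable {Δ : RookComplex ι κ}

/-- A vertex together with its neighbours. -/
def star (Δ : RookComplex ι κ) (v : ι × κ) : Finset (ι × κ) := insert v (Δ.nbrs {v})

theorem mem_star_self (v : ι × κ) : v ∈ Δ.star v := Finset.mem_insert_self _ _

theorem notMem_nbrs_self (v : ι × κ) : v ∉ Δ.nbrs {v} := fun h => (mem_nbrs.1 h).1 (by simp)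

theorem star_subset_verts {v : ι × κ} (hv : v ∈ Δ.nbrs ∅) : Δ.star v ⊆ Δ.nbrs ∅ :=
  Finset.insert_subset hv (nbrs_anti (Finset.empty_subset _))

theorem star_nonattacking {v : ι × κ} (hv : Nonattacking (Δ.nbrs {v})) :
    Nonattacking (Δ.star v) := by
  intro x hx y hy hxy
  rcases Finset.mem_insert.1 hx with rfl | hx'
  · rcases Finset.mem_insert.1 hy with rfl | hy'
    · rfl
    · exact absurd hxy.symm (not_attacks_of_mem_nbrs hy')
  · rcases Finset.mem_insert.1 hy with rfl | hy'
    · exact absurd hxy (not_attacks_of_mem_nbrs hx')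
    · exact hv x hx' y hy' hxy

/-- The star of the vertex is a full set of heavy nonattacking rooks. -/
structure IsTight (Δ : RookComplex ι κ) (w : ι × κ → ℝ) (u : ℝ) (k : ℕ) (v : ι × κ) : Prop where
  mem : v ∈ Δ.nbrs ∅
  nonattacking : Nonattacking (Δ.star v)
  card : (Δ.star v).card = k
  heavy : ∀ c ∈ Δ.star v, u < w c

namespace IsTight

variable {w : ι × κ → ℝ} {u : ℝ} {k : ℕ} {v : ι × κ}

theorem subset_verts (hv : Δ.IsTight w u k v) : Δ.star v ⊆ Δ.nbrs ∅ := star_subset_verts hv.mem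

theorem subset_board (hv : Δ.IsTight w u k v) : Δ.star v ⊆ Δ.rows ×ˢ Δ.cols :=
  hv.subset_verts.trans verts_subset_board

end IsTight

namespace IsDense

variable {w : ι × κ → ℝ} {u : ℝ} {k i : ℕ}

/-- For `i = 1` the absolute bound on the link of a vertex is exactly the definition of large. -/
theorem two_le_of_not_isLarge (h : Δ.IsDense w u k i) {v : ι × κ} (hv : v ∈ Δ.nbrs ∅)
    (hs : ¬ Δ.IsLarge w u k v) : 2 ≤ i := by
  by_contra hi
  have hi1 : i = 1 := by have := h.one_le; omega
  subst hi1
  apply hs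
  have := h.bound₁ {v} (mem_verts.1 hv) (by simp)
  unfold IsLarge
  push_cast at this
  linarith

/-- Discarding `i - 1` of the `t` neighbours leaves weight above `(3k-3i-2)u`, even when the
remaining ones have at most average weight. As the link weighs at most `(3k-5)u`, this gives `3k - 5
< 3t`, so `t ≥ k - 1`; the board gives the converse. -/
theorem card_nbrs_of_not_isLarge (h : Δ.IsDense w u k i) {v : ι × κ} (hv : v ∈ Δ.nbrs ∅)
    (hs : ¬ Δ.IsLarge w u k v) (hna : Nonattacking (Δ.nbrs {v})) :
    (Δ.nbrs {v}).card = k - 1 := by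
  have hi := h.two_le_of_not_isLarge hv hs
  have hu := h.unit_pos (mem_verts.1 hv)
  have hf := mem_verts.1 hv
  have hle : (Δ.star v).card ≤ k := by
    have := (star_nonattacking hna).card_le ((star_subset_verts hv).trans verts_subset_board)
    rwa [h.card_rows] at this
  rw [star, Finset.card_insert_of_notMem (notMem_nbrs_self v)] at hle
  set t := (Δ.nbrs {v}).card with ht
  have hti : i - 1 < t := by
    by_contra hti
    have := h.sdiff_nonempty (X := Δ.nbrs {v}) hf (by rw [Finset.card_singleton]; omega)
    simp at this
  obtain ⟨Z, hZ, hZc, hle'⟩ := exists_subset_card_mul_sum_le w (t - (i - 1)) (Δ.nbrs {v})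
    (by omega)
  have hb := h.bound₁_sdiff (X := Δ.nbrs {v} \ Z) hf
    (by rw [Finset.card_singleton, Finset.card_sdiff_of_subset hZ, hZc]; omega)
  rw [Finset.sdiff_sdiff_eq_self hZ] at hb
  rw [← ht, Nat.cast_sub hti.le, Nat.cast_sub (by omega)] at hle'
  push_cast at hle'
  unfold IsLarge at hs
  have ht0 : (0 : ℝ) < t := by exact_mod_cast (by omega : 0 < t)
  have hti' : (i : ℝ) - 1 < t := by
    have : (i : ℝ) < t + 1 := by exact_mod_cast (by omega : i < t + 1)
    linarith
  have h1 := mul_lt_mul_of_pos_left hb ht0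
  have h2 := mul_le_mul_of_nonneg_left (not_lt.1 hs) (by linarith : (0 : ℝ) ≤ t - (i - 1))
  have h3 : ((i : ℝ) - 1) * u * (3 * k - 5) < (i - 1) * u * (3 * t) := by linarith
  have hi' : (2 : ℝ) ≤ i := by exact_mod_cast hi
  have h4 : (3 * k - 5 : ℝ) < 3 * t :=
    lt_of_mul_lt_mul_left h3 (mul_nonneg (by linarith) hu.le)
  have h5 : (3 * k : ℝ) < 3 * t + 5 := by linarith
  have h6 : 3 * k < 3 * t + 5 := by exact_mod_cast h5
  omega

/-- Retain `a` and `k - 1 - i` light ones among the other `k - 2` neighbours, and discard the rest.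
Comparing the bound outside the discarded cells with the weight of the link leaves `(i - 1)u < (i -
1) w a`. -/
theorem heavy_of_not_isLarge (h : Δ.IsDense w u k i) {v : ι × κ} (hv : v ∈ Δ.nbrs ∅)
    (hs : ¬ Δ.IsLarge w u k v) (hna : Nonattacking (Δ.nbrs {v})) {a : ι × κ}
    (ha : a ∈ Δ.nbrs {v}) : u < w a := by
  have hi := h.two_le_of_not_isLarge hv hs
  have hu := h.unit_pos (mem_verts.1 hv)
  have hf := mem_verts.1 hv
  have hik := h.lt
  have hc := h.card_nbrs_of_not_isLarge hv hs hna
  have hce : ((Δ.nbrs {v}).erase a).card = k - 2 := by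
    rw [Finset.card_erase_of_mem ha, hc]; omega
  obtain ⟨Z, hZ, hZc, hle'⟩ := exists_subset_card_mul_sum_le w (k - 1 - i)
    ((Δ.nbrs {v}).erase a) (by omega)
  have haZ : a ∉ Z := fun haZ => Finset.notMem_erase a _ (hZ haZ)
  have hins : insert a Z ⊆ Δ.nbrs {v} :=
    Finset.insert_subset ha (hZ.trans (Finset.erase_subset _ _))
  have hb := h.bound₁_sdiff (X := Δ.nbrs {v} \ insert a Z) hf
    (by
      rw [Finset.card_singleton, Finset.card_sdiff_of_subset hins,
        Finset.card_insert_of_notMem haZ, hZc, hc]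
      omega)
  rw [Finset.sdiff_sdiff_eq_self hins, Finset.sum_insert haZ] at hb
  have hsum := Finset.add_sum_erase (Δ.nbrs {v}) w ha
  rw [hce, Nat.cast_sub (by omega), Nat.cast_sub (by omega), Nat.cast_sub (by omega)] at hle'
  push_cast at hle'
  unfold IsLarge at hs
  have hk2 : (0 : ℝ) < k - 2 := by
    have : (2 : ℝ) < k := by exact_mod_cast (by omega : 2 < k)
    linarith
  have hki : (0 : ℝ) ≤ k - 1 - i := by
    have : (i : ℝ) + 1 ≤ k := by exact_mod_cast hik
    linarith
  have h1 := mul_lt_mul_of_pos_left hb hk2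
  have h2 := mul_le_mul_of_nonneg_left (not_lt.1 hs) hki
  rw [← hsum] at h2
  have h3 : ((i : ℝ) - 1) * u < (i - 1) * w a := by linarith
  have hi' : (2 : ℝ) ≤ i := by exact_mod_cast hi
  exact lt_of_mul_lt_mul_left h3 (by linarith)

/-- Small vertices with nonattacking neighbours are tight. -/
theorem isTight_of_not_isLarge (h : Δ.IsDense w u k i)
    (hna : ∀ v ∈ Δ.nbrs ∅, ¬ Δ.IsLarge w u k v → Nonattacking (Δ.nbrs {v}))
    {v : ι × κ} (hv : v ∈ Δ.nbrs ∅) (hs : ¬ Δ.IsLarge w u k v) : Δ.IsTight w u k v := by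
  have hik := h.lt
  have hc : (Δ.star v).card = k := by
    rw [star, Finset.card_insert_of_notMem (notMem_nbrs_self v),
      h.card_nbrs_of_not_isLarge hv hs (hna v hv hs)]
    omega
  refine ⟨hv, star_nonattacking (hna v hv hs), hc, fun c hcs => ?_⟩
  rcases Finset.mem_insert.1 hcs with rfl | hcn
  -- The center is heavy either because all other cells of its star are large, or because it is a
  -- neighbour of a small one.
  · by_cases hall : ∀ d ∈ Δ.star c, d ≠ c → Δ.IsLarge w u k d
    · exact h.heavy_of_others_large (star_nonattacking (hna c hv hs)) (star_subset_verts hv) hc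
        (mem_star_self c) hall
    · push Not at hall
      obtain ⟨d, hd, hdc, hds⟩ := hall
      have hd' := (Finset.mem_insert.1 hd).resolve_left hdc
      have hdv := star_subset_verts hv hd
      exact h.heavy_of_not_isLarge hdv hds (hna d hdv hds) (mem_nbrs_comm hd')
  · exact h.heavy_of_not_isLarge hv hs (hna v hv hs) hcn

theorem sum_two_stars_le (h : Δ.IsDense w u k i) {σ τ : Finset (ι × κ)} (hσ : σ ⊆ Δ.nbrs ∅)
    (hτ : τ ⊆ Δ.nbrs ∅) :
    ∑ c ∈ σ ∩ τ, w c + ∑ c ∈ σ \ τ, w c + ∑ c ∈ τ \ σ, w c ≤ (3 * k - 2) * u := by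
  rw [← h.total]
  refine le_trans (le_of_eq ?_) (h.sum_mono (Finset.union_subset hσ hτ))
  rw [Finset.sum_inter_add_sum_sdiff, ← Finset.union_sdiff_self_eq_union,
    Finset.sum_union Finset.disjoint_sdiff]

/-- Adjacent tight vertices have the same star. -/
theorem star_eq_of_mem_nbrs (h : Δ.IsDense w u k i) (hi : 2 ≤ i) {v c : ι × κ}
    (hv : Δ.IsTight w u k v) (hc : Δ.IsTight w u k c) (hvc : c ∈ Δ.nbrs {v}) :
    Δ.star v = Δ.star c := by
  by_contra hne
  have hu := h.unit_pos (mem_verts.1 hv.mem)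
  have hface : {c, v} ∈ Δ.faces := (mem_nbrs.1 hvc).2
  have hcv : c ≠ v := fun he => (mem_nbrs.1 hvc).1 (by simp [he])
  set U := Δ.nbrs {v} ∩ Δ.nbrs {c} with hU
  have hnU : Δ.nbrs {c, v} ⊆ U := fun x hx => Finset.mem_inter.2
    ⟨nbrs_anti (by simp) hx, nbrs_anti (by simp) hx⟩
  have hd2 := hc.nonattacking.two_le_card_sdiff hv.nonattacking hc.subset_board hv.subset_board
    (by rw [h.card_rows, hv.card]) (by rw [h.card_cols, hv.card]) (by rw [hv.card, hc.card])
    (Ne.symm hne)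
  have hcU : c ∉ U := fun hcU => notMem_nbrs_self c (Finset.mem_inter.1 hcU).2
  have hvU : v ∉ insert c U := by
    rw [Finset.mem_insert, not_or]
    exact ⟨hcv.symm, fun hvU => notMem_nbrs_self v (Finset.mem_inter.1 hvU).1⟩
  have hinter : Δ.star v ∩ Δ.star c = insert v (insert c U) := by
    ext x
    have := mem_nbrs_comm hvc
    simp only [star, hU, Finset.mem_inter, Finset.mem_insert]
    constructor
    · rintro ⟨rfl | h1, rfl | h2⟩ <;> simp [*]
    · rintro (rfl | rfl | h1) <;> simp [*]
  have hcardI : (Δ.star v ∩ Δ.star c).card = U.card + 2 := by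
    rw [hinter, Finset.card_insert_of_notMem hvU, Finset.card_insert_of_notMem hcU]
  have h1 := Finset.card_inter_add_card_sdiff (Δ.star v) (Δ.star c)
  have h2 := Finset.card_inter_add_card_sdiff (Δ.star c) (Δ.star v)
  rw [Finset.inter_comm (Δ.star c), hcardI, hc.card] at h2
  rw [hcardI, hv.card] at h1
  have hsum := h.sum_two_stars_le hv.subset_verts hc.subset_verts
  have hs1 := card_mul_le_sum_of_lt (Δ.star v \ Δ.star c) (fun x hx => hv.heavy x (Finset.sdiff_subset hx))
  have hs2 := card_mul_le_sum_of_lt (Δ.star c \ Δ.star v) (fun x hx => hc.heavy x (Finset.sdiff_subset hx))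
  rw [hinter, Finset.sum_insert hvU, Finset.sum_insert hcU] at hsum
  have hwv := hv.heavy v (mem_star_self v)
  have hwc := hc.heavy c (mem_star_self c)
  have hdd : (Δ.star c \ Δ.star v).card = (Δ.star v \ Δ.star c).card := by omega
  rw [hdd] at hs2
  set d := (Δ.star v \ Δ.star c).card with hd
  set t := U.card with ht
  -- The face `{c, v}` leaves room for discarding `i - 2` common neighbours, and some neighbour must
  -- survive.
  have hti : i - 2 < t := by
    by_contra hti
    obtain ⟨x, hx⟩ := h.sdiff_nonempty (X := U) hface (by rw [Finset.card_pair hcv]; omega)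
    rw [Finset.mem_sdiff] at hx
    exact hx.2 (hnU hx.1)
  obtain ⟨Z, hZ, hZc, hle⟩ := exists_subset_card_mul_sum_le w (t - (i - 2)) U (by omega)
  have hb := h.bound₁_sdiff (X := U \ Z) hface
    (by rw [Finset.card_pair hcv, Finset.card_sdiff_of_subset hZ, hZc]; omega)
  have hb' := hb.trans_le (h.sum_mono (Y := Z) (fun x hx => by
    rw [Finset.mem_sdiff, Finset.mem_sdiff, not_and, not_not] at hx
    exact hx.2 (hnU hx.1)))
  rw [← ht] at hle
  -- Parametrize by `i = j + 2`, `t = j + m + 1` and `k = t + 2 + d`. The total bounds the weight of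
  -- `U`, since `v`, `c` and the `2d` unshared cells each weigh more than `u`; the average bound on
  -- `Z` then fails for `d ≥ 2`.
  obtain ⟨m, hm⟩ := Nat.exists_eq_add_of_lt hti
  obtain ⟨j, rfl⟩ := Nat.exists_eq_add_of_le hi
  rw [show t - (2 + j - 2) = m + 1 by omega] at hle
  have htm : (t : ℝ) = j + m + 1 := by
    rw [hm, show 2 + j - 2 = j by omega]; push_cast; ring
  have hkd : (k : ℝ) = j + m + 1 + 2 + d := by
    rw [← htm]; exact_mod_cast (by omega : k = t + 2 + d)
  have hd2' : (2 : ℝ) ≤ d := by exact_mod_cast hdd ▸ (by omega : 2 ≤ (Δ.star c \ Δ.star v).card)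
  rw [htm] at hle
  rw [hkd] at hb' hsum
  push_cast at hle hb'
  have hj : (0 : ℝ) ≤ j := Nat.cast_nonneg j
  have hm0 : (0 : ℝ) ≤ m := Nat.cast_nonneg m
  have e1 := mul_lt_mul_of_pos_left hb' (by linarith : (0 : ℝ) < j + m + 1)
  have e2 : ∑ x ∈ U, w x ≤ (3 * (j + m + 1 + 2 + d) - 2 - 2 - 2 * d) * u := by linarith
  have e3 := mul_le_mul_of_nonneg_left e2 (by linarith : (0 : ℝ) ≤ m + 1)
  have e4 : 0 ≤ ((m + 1) * (2 * d - 4) + j * (3 * d - 2)) * u := by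
    have : (0 : ℝ) ≤ 2 * d - 4 := by linarith
    have : (0 : ℝ) ≤ 3 * d - 2 := by linarith
    positivity
  linarith

/-- There are no two different stars `σ` and `τ`, provided that the cells in just one of them are
centers and the common ones are large. -/
theorem false_of_two_stars (h : Δ.IsDense w u k i) {σ τ : Finset (ι × κ)}
    (hσ : σ ⊆ Δ.nbrs ∅) (hτ : τ ⊆ Δ.nbrs ∅) (hσc : σ.card = k) (hτc : τ.card = k)
    (hd : 2 ≤ (σ \ τ).card)
    (hστ : ∀ c ∈ σ \ τ, Δ.star c = σ) (hτσ : ∀ c ∈ τ \ σ, Δ.star c = τ)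
    (hu : 0 < u) (hlight : ∀ c ∈ σ ∩ τ, w c ≤ 3 * u) : False := by
  have hik := h.lt
  have h1i := h.one_le
  have h1 := Finset.card_inter_add_card_sdiff σ τ
  have h2 := Finset.card_inter_add_card_sdiff τ σ
  rw [Finset.inter_comm τ, hτc] at h2
  rw [hσc] at h1
  set d := (σ \ τ).card with hdd
  have hC : (σ ∩ τ).card = k - d := by omega
  have hE : (τ \ σ).card = d := by omega
  have hd0 : (0 : ℝ) < d := by exact_mod_cast (by omega : 0 < d)
  -- `s` is the average weight of a common cell, or `0` if there is none.
  obtain ⟨s, hs⟩ : ∃ s : ℝ, ((k - d : ℕ) : ℝ) * s = ∑ c ∈ σ ∩ τ, w c ∧ s ≤ 3 * u := by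
    have hle : ∑ c ∈ σ ∩ τ, w c ≤ ((k - d : ℕ) : ℝ) * (3 * u) := by
      simpa [hC] using Finset.sum_le_card_nsmul (σ ∩ τ) w (3 * u) hlight
    rcases Nat.eq_zero_or_pos (k - d) with h0 | hpos
    · rw [h0] at hC
      rw [Finset.card_eq_zero.1 hC, h0]
      exact ⟨0, by simp, by linarith⟩
    · have hpos' : (0 : ℝ) < ((k - d : ℕ) : ℝ) := by exact_mod_cast hpos
      exact ⟨(∑ c ∈ σ ∩ τ, w c) / ((k - d : ℕ) : ℝ), by field_simp,
        by rw [div_le_iff₀ hpos']; linarith⟩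
  have avg : ∀ (D : Finset (ι × κ)) (ρ : Finset (ι × κ)), D.card = d → ρ.card = k →
      D ⊆ ρ → Disjoint D (σ ∩ τ) → σ ∩ τ ⊆ ρ → (∀ c ∈ D, Δ.star c = ρ) → D ⊆ Δ.nbrs ∅ →
      ∀ j l : ℕ, j < d → l ≤ k - d → j + l = k - i →
      ∃ t : ℝ, t ≤ j * ((∑ c ∈ D, w c) / d) + l * s ∧ (3 * k - 3 * i - 2) * u < t ∧
        ((k : ℝ) - i) * ((3 * k - 2) * u) < (k + 2) * t := by
    intro D ρ hD hρ hDρ hdisj hCρ hstar hDv j l hj hl hjl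
    obtain ⟨Z, hZ, hZc, hZw⟩ := exists_subset_card_mul_sum_le w j D (by omega)
    obtain ⟨Y, hY, hYc, hYw⟩ := exists_subset_card_mul_sum_le w l (σ ∩ τ) (by omega)
    have hZY : Disjoint Z Y := Finset.disjoint_of_subset_left hZ
      (Finset.disjoint_of_subset_right hY hdisj)
    -- Since `j < d`, a cell of `D` is left over to serve as center; discarding the other `i - 1`
    -- cells of its star leaves exactly `Z ∪ Y`.
    obtain ⟨c, hcD, hcZ⟩ : ∃ c ∈ D, c ∉ Z := by
      by_contra hcon
      push Not at hcon
      have := Finset.card_le_card hcon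
      omega
    have hcY : c ∉ Y := fun hcY => Finset.disjoint_left.1 hdisj hcD (hY hcY)
    have hnb : Δ.nbrs {c} = ρ.erase c := by
      rw [← hstar c hcD, star, Finset.erase_insert (notMem_nbrs_self c)]
    have hsub : Z ∪ Y ⊆ Δ.nbrs {c} := by
      rw [hnb]
      intro x hx
      rw [Finset.mem_erase]
      refine ⟨?_, ?_⟩
      · rintro rfl
        exact (Finset.mem_union.1 hx).elim hcZ hcY
      · exact (Finset.mem_union.1 hx).elim (fun hx => hDρ (hZ hx)) (fun hx => hCρ (hY hx))
    have hcard : ({c} : Finset (ι × κ)).card + (Δ.nbrs {c} \ (Z ∪ Y)).card ≤ i := by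
      rw [Finset.card_sdiff_of_subset hsub, Finset.card_union_of_disjoint hZY, hZc, hYc, hnb,
        Finset.card_erase_of_mem (hDρ hcD), hρ, Finset.card_singleton]
      omega
    have hcf := mem_verts.1 (hDv hcD)
    have hb1 := h.bound₁_sdiff hcf hcard
    have hb2 := h.bound₂_sdiff hcf hcard
    rw [Finset.sdiff_sdiff_eq_self hsub] at hb1 hb2
    refine ⟨_, ?_, hb1, hb2⟩
    rw [Finset.sum_union hZY]
    refine add_le_add ?_ ?_
    · rw [hD] at hZw
      rw [← mul_div_assoc, le_div_iff₀ hd0]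
      linarith
    · rw [hC, ← hs.1] at hYw
      rcases Nat.eq_zero_or_pos (k - d) with h0 | hpos
      · have hl0 : l = 0 := by omega
        rw [hl0] at hYc
        rw [Finset.card_eq_zero.1 hYc, hl0]
        simp
      · have hpos' : (0 : ℝ) < ((k - d : ℕ) : ℝ) := by exact_mod_cast hpos
        refine le_of_mul_le_mul_left ?_ hpos'
        linarith
  have hsum := h.sum_two_stars_le hσ hτ
  rw [← hs.1] at hsum
  have hdk : d ≤ k := by omega
  -- The bounds from the two stars are averaged, so that one variable `P` stands for both private
  -- parts.
  refine false_of_average_bounds (k := k) (i := i) (d := d) (u := u) (s := s)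
    (P := ((∑ c ∈ σ \ τ, w c) / d + (∑ c ∈ τ \ σ, w c) / d) / 2) h1i hik hd hdk hu hs.2 ?_ ?_
  · rw [Nat.cast_sub hdk] at hsum
    have : 2 * d * (((∑ c ∈ σ \ τ, w c) / d + (∑ c ∈ τ \ σ, w c) / d) / 2)
        = ∑ c ∈ σ \ τ, w c + ∑ c ∈ τ \ σ, w c := by field_simp
    rw [this]
    linarith
  · intro j l hj hl hjl
    obtain ⟨t₁, ht₁, hb₁, hb₁'⟩ := avg (σ \ τ) σ rfl hσc Finset.sdiff_subset
      (Finset.disjoint_left.2 (fun x hx hx' =>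
        (Finset.mem_sdiff.1 hx).2 (Finset.mem_inter.1 hx').2))
      Finset.inter_subset_left hστ (Finset.sdiff_subset.trans hσ) j l hj hl hjl
    obtain ⟨t₂, ht₂, hb₂, hb₂'⟩ := avg (τ \ σ) τ hE hτc Finset.sdiff_subset
      (Finset.disjoint_left.2 (fun x hx hx' =>
        (Finset.mem_sdiff.1 hx).2 (Finset.mem_inter.1 hx').1))
      Finset.inter_subset_right hτσ (Finset.sdiff_subset.trans hτ) j l hj hl hjl
    have ht : (t₁ + t₂) / 2 ≤ j * (((∑ c ∈ σ \ τ, w c) / d + (∑ c ∈ τ \ σ, w c) / d) / 2) + l * s := by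
      linarith
    refine ⟨by linarith, ?_⟩
    have := mul_le_mul_of_nonneg_left ht (by positivity : (0 : ℝ) ≤ k + 2)
    linarith

end IsDense

end RookComplex

end Board

/-! ### Links of vertices and the induction on `i`. -/

section Board

variable {ι κ : Type*} [DecidableEq ι] [DecidableEq κ]

namespace RookComplex

variable {Δ : RookComplex ι κ}

/-- The link of a vertex. -/
def vertexLink (Δ : RookComplex ι κ) (v : ι × κ) : RookComplex ι κ where
  rows := Δ.rows.erase v.1
  cols := Δ.cols.erase v.2
  faces := Δ.faces.filter (fun S => v ∉ S ∧ insert v S ∈ Δ.faces)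
  down_closed := by
    intro S hS T hT
    rw [Finset.mem_filter] at hS ⊢
    exact ⟨Δ.down_closed _ hS.1 _ hT, fun hv => hS.2.1 (hT hv),
      Δ.down_closed _ hS.2.2 _ (Finset.insert_subset_insert _ hT)⟩
  subset_board := by
    intro S hS x hx
    rw [Finset.mem_filter] at hS
    have hb := Finset.mem_product.1 (Δ.subset_board _ hS.1 hx)
    have hne : x ≠ v := fun he => hS.2.1 (he ▸ hx)
    exact Finset.mem_product.2
      ⟨Finset.mem_erase.2 ⟨fun he => hne (Δ.row_inj _ hS.2.2 (by simp [hx]) (by simp) he), hb.1⟩,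
       Finset.mem_erase.2 ⟨fun he => hne (Δ.col_inj _ hS.2.2 (by simp [hx]) (by simp) he), hb.2⟩⟩
  row_inj := fun S hS => Δ.row_inj S (Finset.mem_filter.1 hS).1
  col_inj := fun S hS => Δ.col_inj S (Finset.mem_filter.1 hS).1

theorem mem_vertexLink_faces {v : ι × κ} {S : Finset (ι × κ)} :
    S ∈ (Δ.vertexLink v).faces ↔ v ∉ S ∧ insert v S ∈ Δ.faces := by
  simp only [vertexLink, Finset.mem_filter, and_iff_right_iff_imp]
  exact fun h => Δ.down_closed _ h.2 _ (Finset.subset_insert _ _)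

theorem vertexLink_nbrs {v : ι × κ} {S : Finset (ι × κ)} (hv : v ∉ S) :
    (Δ.vertexLink v).nbrs S = Δ.nbrs (insert v S) := by
  ext c
  rw [mem_nbrs, mem_nbrs, mem_vertexLink_faces, Finset.insert_comm v c]
  simp only [Finset.mem_insert, not_or]
  constructor
  · rintro ⟨h1, ⟨h2, -⟩, h3⟩
    exact ⟨⟨Ne.symm h2, h1⟩, h3⟩
  · rintro ⟨⟨h1, h2⟩, h3⟩
    exact ⟨h2, ⟨Ne.symm h1, hv⟩, h3⟩

namespace IsDense

variable {w : ι × κ → ℝ} {u : ℝ} {k i : ℕ}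

/-- The link of a small vertex is dense. -/
theorem vertexLink (h : Δ.IsDense w u k i) {v : ι × κ} (hv : v ∈ Δ.nbrs ∅)
    (hs : ¬ Δ.IsLarge w u k v) :
    (Δ.vertexLink v).IsDense w ((∑ c ∈ Δ.nbrs {v}, w c) / (3 * k - 5)) (k - 1) (i - 1) := by
  have hi := h.two_le_of_not_isLarge hv hs
  have hik := h.lt
  have hk : (3 : ℝ) ≤ k := by exact_mod_cast (by omega : 3 ≤ k)
  have hki : (i : ℝ) + 1 ≤ k := by exact_mod_cast hik
  have hvb := Finset.mem_product.1 (verts_subset_board hv)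
  unfold IsLarge at hs
  set n := ∑ c ∈ Δ.nbrs {v}, w c with hn
  have hn0 : 0 ≤ n := h.sum_nonneg _
  have hle : n / (3 * k - 5) ≤ u := by
    rw [div_le_iff₀ (by linarith)]; linarith
  have hge : 0 ≤ n / (3 * k - 5) := div_nonneg hn0 (by linarith)
  have hmul : (3 * k - 5) * (n / (3 * k - 5)) = n := by
    field_simp [show (3 * k - 5 : ℝ) ≠ 0 by linarith]
  have hlink : ∀ S ∈ (Δ.vertexLink v).faces,
      v ∉ S ∧ insert v S ∈ Δ.faces ∧ (insert v S).card = S.card + 1 ∧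
        (Δ.vertexLink v).nbrs S = Δ.nbrs (insert v S) := fun S hS => by
    rw [mem_vertexLink_faces] at hS
    exact ⟨hS.1, hS.2, Finset.card_insert_of_notMem hS.1, vertexLink_nbrs hS.1⟩
  have hkc : ((k - 1 : ℕ) : ℝ) = k - 1 := by rw [Nat.cast_sub (by omega)]; simp
  have hic : ((i - 1 : ℕ) : ℝ) = i - 1 := by rw [Nat.cast_sub (by omega)]; simp
  refine ⟨h.nonneg, by omega, by omega, ?_, ?_, ?_, ?_, ?_, ?_⟩
  · change (Δ.rows.erase v.1).card = _
    rw [Finset.card_erase_of_mem hvb.1, h.card_rows]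
  · change (Δ.cols.erase v.2).card = _
    rw [Finset.card_erase_of_mem hvb.2, h.card_cols]
  · intro S hS hSi
    obtain ⟨-, h2, h3, h4⟩ := hlink S hS
    rw [h4]
    exact h.extend _ h2 (by omega)
  · rw [vertexLink_nbrs (by simp), hkc]
    change n = _
    linarith
  · intro S hS hSi
    obtain ⟨-, h2, h3, h4⟩ := hlink S hS
    have := h.bound₁ _ h2 (by omega)
    rw [h4, hkc, hic]
    refine lt_of_le_of_lt ?_ this
    have := mul_le_mul_of_nonneg_left hle (by linarith : (0 : ℝ) ≤ 3 * k - 3 * i - 2)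
    linarith
  · intro S hS hSi
    obtain ⟨-, h2, h3, h4⟩ := hlink S hS
    have hb := h.bound₂ _ h2 (by omega)
    rw [h4, hkc, hic]
    set W := ∑ c ∈ Δ.nbrs (insert v S), w c
    set u' := n / (3 * k - 5)
    have e1 := mul_le_mul_of_nonneg_left hle
      (by have : (0 : ℝ) ≤ k - i := by linarith
          have : (0 : ℝ) ≤ 3 * k - 2 := by linarith
          positivity : (0 : ℝ) ≤ (k - i) * (3 * k - 2))
    have e2 : ((k : ℝ) - i) * (3 * k - 2) * u' < (k + 2) * W := by linarith
    have e3 : 0 ≤ ((k : ℝ) - i) * u' := mul_nonneg (by linarith) hge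
    have e4 := mul_lt_mul_of_pos_left e2 (by linarith : (0 : ℝ) < k + 1)
    refine lt_of_mul_lt_mul_left (a := (k : ℝ) + 2) ?_ (by linarith)
    -- The relative bound passes to the link because `(3k-5)/(k+1) ≤ (3k-2)/(k+2)`.
    have e5 : ((k : ℝ) + 2) * ((k - i) * (3 * k - 5) * u')
        ≤ (k + 1) * ((k - i) * (3 * k - 2) * u') := by
      have : ((k : ℝ) + 1) * (3 * k - 2) - (k + 2) * (3 * k - 5) = 8 := by ring
      nlinarith
    linarith

/-- A large vertex outside a full set of heavy nonattacking rooks has no further heavy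
nonneighbour. -/
theorem false_of_large_outside (h : Δ.IsDense w u k i) {σ : Finset (ι × κ)}
    (hσ : Nonattacking σ) (hsub : σ ⊆ Δ.nbrs ∅) (hcard : σ.card = k)
    (hheavy : ∀ c ∈ σ, u < w c) {z x : ι × κ} (hz : z ∈ Δ.nbrs ∅) (hzσ : z ∉ σ)
    (hl : Δ.IsLarge w u k z) (hx : x ∈ Δ.nbrs ∅) (hwx : u < w x) (hxz : x ∉ Δ.nbrs {z})
    (hxσ : x ∈ σ → ¬ Attacks z x) : False := by
  have hb := hsub.trans verts_subset_board
  have hzb := Finset.mem_product.1 (verts_subset_board hz)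
  obtain ⟨a, ha, haz⟩ := hσ.exists_row hb (by rw [h.card_rows, hcard]) hzb.1
  obtain ⟨b, hbσ, hbz⟩ := hσ.exists_col hb (by rw [h.card_cols, hcard]) hzb.2
  have hab : a ≠ b := by
    rintro rfl
    exact hzσ (by rwa [← Prod.ext haz hbz])
  have hax : a ≠ x := by
    rintro rfl
    exact hxσ ha (Or.inl haz.symm)
  have hbx : b ≠ x := by
    rintro rfl
    exact hxσ hbσ (Or.inr hbz.symm)
  exact h.three_heavy hl hab hax hbx (hsub ha) (hsub hbσ) hx
    (fun hc => not_attacks_of_mem_nbrs hc (Or.inl haz))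
    (fun hc => not_attacks_of_mem_nbrs hc (Or.inr hbz)) hxz
    (hheavy a ha) (hheavy b hbσ) hwx

theorem star_eq_of_mem_star (h : Δ.IsDense w u k i) (hi : 2 ≤ i) {v c : ι × κ}
    (hv : Δ.IsTight w u k v) (hc : Δ.IsTight w u k c) (hvc : c ∈ Δ.star v) :
    Δ.star c = Δ.star v := by
  rcases Finset.mem_insert.1 hvc with rfl | hcn
  · rfl
  · exact (h.star_eq_of_mem_nbrs hi hv hc hcn).symm

/-- If small vertices have nonattacking neighbours, then all vertices are nonattacking. -/
theorem nonattacking_of_links (h : Δ.IsDense w u k i)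
    (hna : ∀ v ∈ Δ.nbrs ∅, ¬ Δ.IsLarge w u k v → Nonattacking (Δ.nbrs {v})) :
    Nonattacking (Δ.nbrs ∅) := by
  by_cases hall : ∀ v ∈ Δ.nbrs ∅, Δ.IsLarge w u k v
  · exact h.nonattacking_of_all_large hall
  push Not at hall
  obtain ⟨v, hv, hvs⟩ := hall
  have hu := h.unit_pos (mem_verts.1 hv)
  have hi := h.two_le_of_not_isLarge hv hvs
  have htight : ∀ c ∈ Δ.nbrs ∅, ¬ Δ.IsLarge w u k c → Δ.IsTight w u k c :=
    fun c hc hcs => h.isTight_of_not_isLarge hna hc hcs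
  have hvt := htight v hv hvs
  by_cases hone : ∀ b ∈ Δ.nbrs ∅, ¬ Δ.IsLarge w u k b → Δ.star b = Δ.star v
  · have hsub : Δ.nbrs ∅ ⊆ Δ.star v := by
      have hout : ∀ z ∈ Δ.nbrs ∅, z ∉ Δ.star v → Δ.IsLarge w u k z := by
        intro z hz hzσ
        by_contra hzs
        exact hzσ (hone z hz hzs ▸ mem_star_self z)
      refine fun z hz => h.mem_of_large_outside hvt.nonattacking hvt.subset_verts hvt.card
        hvt.heavy hout ?_ hz
      intro z hz hzσ c hc hzc
      by_contra hcs
      have hcv := hvt.subset_verts hc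
      have hst := hone c hcv hcs
      -- A small `c` in the common star is not adjacent to `z`, as `z` lies outside that star. With
      -- the two rooks attacking `z`, it would be a third heavy nonneighbour.
      refine h.false_of_large_outside hvt.nonattacking hvt.subset_verts hvt.card
        hvt.heavy hz hzσ (hout z hz hzσ) hcv (hvt.heavy c hc) ?_ (fun _ => hzc)
      intro hcz
      exact hzσ (hst ▸ Finset.mem_insert_of_mem (mem_nbrs_comm hcz))
    intro x hx y hy
    exact hvt.nonattacking x (hsub hx) y (hsub hy)
  · push Not at hone
    obtain ⟨b, hb, hbs, hne⟩ := hone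
    have hbt := htight b hb hbs
    have hcenter : ∀ {v b : ι × κ}, Δ.IsTight w u k v → Δ.IsTight w u k b →
        ∀ c ∈ Δ.star v \ Δ.star b, Δ.star c = Δ.star v := by
      intro v b hvt hbt c hc
      rw [Finset.mem_sdiff] at hc
      have hcv := hvt.subset_verts hc.1
      by_cases hcs : Δ.IsLarge w u k c
      -- A large `c` outside the other star would have as heavy nonneighbours itself and the two
      -- rooks there that attack it.
      · exact (h.false_of_large_outside hbt.nonattacking hbt.subset_verts hbt.card hbt.heavy
          hcv hc.2 hcs hcv (hvt.heavy c hc.1) (notMem_nbrs_self c)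
          (fun hcb => absurd hcb hc.2)).elim
      · exact h.star_eq_of_mem_star hi hvt (htight c hcv hcs) hc.1
    refine (h.false_of_two_stars hvt.subset_verts hbt.subset_verts hvt.card hbt.card ?_
      (hcenter hvt hbt) (hcenter hbt hvt) hu ?_).elim
    · exact hbt.nonattacking.two_le_card_sdiff hvt.nonattacking hbt.subset_board
        hvt.subset_board (by rw [h.card_rows, hvt.card]) (by rw [h.card_cols, hvt.card])
        (by rw [hvt.card, hbt.card]) hne
    · intro c hc
      rw [Finset.mem_inter] at hc
      have hcv := hvt.subset_verts hc.1
      by_cases hcs : Δ.IsLarge w u k c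
      -- A vertex is a nonneighbour of itself, so a large one weighs less than `3u`. A small common
      -- cell would make both stars equal to its own.
      · have := h.sum_lt_of_isLarge hcs (X := {c}) (by simpa using hcv)
          (by simpa using notMem_nbrs_self c)
        rw [Finset.sum_singleton] at this
        exact this.le
      · have hct := htight c hcv hcs
        exact absurd ((h.star_eq_of_mem_star hi hbt hct hc.2).symm.trans
          (h.star_eq_of_mem_star hi hvt hct hc.1)) hne

end IsDense

/-- No two vertices of a dense complex of nonattacking rooks attack each other. -/
theorem IsDense.nonattacking {w : ι × κ → ℝ} {u : ℝ} {k i : ℕ} (h : Δ.IsDense w u k i) :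
    Nonattacking (Δ.nbrs ∅) := by
  induction i generalizing Δ u k with
  | zero => exact absurd h.one_le (by omega)
  | succ i ih =>
    refine h.nonattacking_of_links (fun v hv hs => ?_)
    have := ih (h.vertexLink hv hs)
    rwa [vertexLink_nbrs (by simp)] at this

end RookComplex

end Board

/-! ### Maclaurin's inequality and the count of rainbow sets. -/

/-- A tangent line bound for powers. -/
theorem mul_pow_mul_le_pow_add {A M : ℝ} (hA : 0 ≤ A) (hM : 0 ≤ M) (s : ℕ) :
    (s + 1) * (M * A ^ s) ≤ M ^ (s + 1) + s * A ^ (s + 1) := by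
  induction s with
  | zero => simp
  | succ s ih =>
    have h1 := mul_le_mul_of_nonneg_right ih hA
    have h2 : 0 ≤ (M ^ (s + 1) - A ^ (s + 1)) * (M - A) := by
      rcases le_total A M with h | h
      · exact mul_nonneg (sub_nonneg.2 (pow_le_pow_left₀ hA h _)) (sub_nonneg.2 h)
      · exact mul_nonneg_of_nonpos_of_nonpos (sub_nonpos.2 (pow_le_pow_left₀ hM h _))
          (sub_nonpos.2 h)
    push_cast
    linear_combination h1 + h2

/-- Maclaurin's inequality between an elementary symmetric sum and the arithmetic mean. -/
theorem sum_prod_powersetCard_le {α : Type*} [DecidableEq α] {x : α → ℝ} (hx : ∀ a, 0 ≤ x a)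
    (Q : Finset α) (s : ℕ) :
    ∑ P ∈ Q.powersetCard s, ∏ a ∈ P, x a
      ≤ (Q.card.choose s : ℝ) * ((∑ a ∈ Q, x a) / Q.card) ^ s := by
  induction Q using Finset.induction_on generalizing s with
  | empty =>
    cases s with
    | zero => simp
    | succ s => rw [Finset.powersetCard_eq_empty.2 (by simp)]; simp
  | insert b Q hb ih =>
    cases s with
    | zero => simp
    | succ s =>
      rw [Finset.powersetCard_succ_insert hb, Finset.sum_union]
      · rw [Finset.sum_image]
        · have hprod : ∀ P ∈ Q.powersetCard s, ∏ a ∈ insert b P, x a = x b * ∏ a ∈ P, x a := by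
            intro P hP
            exact Finset.prod_insert (fun hbP => hb ((Finset.mem_powersetCard.1 hP).1 hbP))
          rw [Finset.sum_congr rfl hprod, ← Finset.mul_sum, Finset.sum_insert hb,
            Finset.card_insert_of_notMem hb]
          set q := Q.card with hq
          set A := (∑ a ∈ Q, x a) / q with hA
          have hA0 : 0 ≤ A := div_nonneg (Finset.sum_nonneg (fun a _ => hx a)) (Nat.cast_nonneg _)
          have hqA : ∑ a ∈ Q, x a = q * A := by
            rcases Nat.eq_zero_or_pos q with h0 | hpos
            · simp [Finset.card_eq_zero.1 (hq.symm.trans h0), h0]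
            · have : (q : ℝ) ≠ 0 := by exact_mod_cast hpos.ne'
              rw [hA]; field_simp
          rw [hqA]
          set M := (x b + q * A) / ((q + 1 : ℕ) : ℝ) with hM
          have hM0 : 0 ≤ M := div_nonneg (add_nonneg (hx b)
            (mul_nonneg (Nat.cast_nonneg _) hA0)) (Nat.cast_nonneg _)
          have hxb : x b = (q + 1) * M - q * A := by
            rw [hM]; push_cast; field_simp; ring
          have i1 := ih (s + 1)
          have i2 := mul_le_mul_of_nonneg_left (ih s) (hx b)
          have c1 : ((q + 1).choose (s + 1) : ℝ) = q.choose s + q.choose (s + 1) := by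
            exact_mod_cast Nat.choose_succ_succ q s
          have c2 : ((q : ℝ) + 1) * q.choose s = (q + 1).choose (s + 1) * (s + 1) := by
            exact_mod_cast Nat.add_one_mul_choose_eq q s
          have t := mul_le_mul_of_nonneg_left (mul_pow_mul_le_pow_add hA0 hM0 s)
            (Nat.cast_nonneg ((q + 1).choose (s + 1)) : (0 : ℝ) ≤ _)
          -- Let `A` and `M` be the means before and after adding `b`. Pascal's rule and the
          -- absorption identity bring the inductive bound to the left side of the tangent
          -- inequality at `A`.
          have e : (q.choose (s + 1) : ℝ) * A ^ (s + 1) + x b * (q.choose s * A ^ s)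
              = (q + 1).choose (s + 1) * ((s + 1) * (M * A ^ s))
                - (q + 1).choose (s + 1) * (s * A ^ (s + 1)) := by
            have c3 : (q.choose (s + 1) : ℝ) = (q + 1).choose (s + 1) - q.choose s := by linarith
            rw [c3, hxb, pow_succ]
            linear_combination (M * A ^ s - A ^ s * A) * c2
          linarith
        · intro P hP P' hP' h
          rw [Finset.mem_coe, Finset.mem_powersetCard] at hP hP'
          rw [← Finset.erase_insert (fun hbP => hb (hP.1 hbP)),
            ← Finset.erase_insert (fun hbP => hb (hP'.1 hbP)), h]
      · rw [Finset.disjoint_left]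
        intro P hP hP'
        obtain ⟨R, -, rfl⟩ := Finset.mem_image.1 hP'
        exact hb ((Finset.mem_powersetCard.1 hP).1 (Finset.mem_insert_self _ _))

/-- The `s`-subsets of `N` on which `ψ` is injective. -/
def rainbowSets {V C : Type*} [DecidableEq C] (ψ : V → C) (N : Finset V) (s : ℕ) :
    Finset (Finset V) :=
  (N.powersetCard s).filter (fun f => (f.image ψ).card = f.card)

theorem mem_rainbowSets {V C : Type*} [DecidableEq C] {ψ : V → C} {N : Finset V} {s : ℕ}
    {f : Finset V} :
    f ∈ rainbowSets ψ N s ↔ f ⊆ N ∧ f.card = s ∧ Set.InjOn ψ f := by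
  rw [rainbowSets, Finset.mem_filter, Finset.mem_powersetCard, Finset.card_image_iff, and_assoc]

theorem card_rainbowSets_image {V C : Type*} [DecidableEq V] [DecidableEq C] (ψ : V → C)
    (N : Finset V) (P : Finset C) :
    ((rainbowSets ψ N P.card).filter (fun f => f.image ψ = P)).card
      = ∏ c ∈ P, (N.filter (fun v => ψ v = c)).card := by
  rw [← Finset.card_pi]
  symm
  have hψ : ∀ g ∈ P.pi (fun c => N.filter (fun v => ψ v = c)), ∀ c (hc : c ∈ P),
      g c hc ∈ N ∧ ψ (g c hc) = c := fun g hg c hc =>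
    Finset.mem_filter.1 (Finset.mem_pi.1 hg c hc)
  refine Finset.card_bij (fun g _ => P.attach.image (fun c => g c.1 c.2)) ?_ ?_ ?_
  · intro g hg
    have himg : (P.attach.image (fun c => g c.1 c.2)).image ψ = P := by
      ext c
      simp only [Finset.mem_image, Finset.mem_attach, true_and]
      constructor
      · rintro ⟨v, ⟨d, rfl⟩, rfl⟩
        rw [(hψ g hg _ d.2).2]; exact d.2
      · exact fun hc => ⟨g c hc, ⟨⟨c, hc⟩, rfl⟩, (hψ g hg c hc).2⟩
    have hcard : (P.attach.image (fun c => g c.1 c.2)).card = P.card := by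
      rw [Finset.card_image_of_injective, Finset.card_attach]
      intro c d hcd
      apply Subtype.ext
      rw [← (hψ g hg _ c.2).2, ← (hψ g hg _ d.2).2]
      exact congrArg ψ hcd
    refine Finset.mem_filter.2 ⟨mem_rainbowSets.2 ⟨?_, hcard, ?_⟩, himg⟩
    · intro v hv
      obtain ⟨c, -, rfl⟩ := Finset.mem_image.1 hv
      exact (hψ g hg _ c.2).1
    · rw [← Finset.card_image_iff, himg, hcard]
  · intro g hg g' hg' h
    funext c hc
    have : g c hc ∈ P.attach.image (fun c => g' c.1 c.2) := by
      rw [← h]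
      exact Finset.mem_image.2 ⟨⟨c, hc⟩, Finset.mem_attach _ _, rfl⟩
    obtain ⟨⟨d, hd⟩, -, hdc⟩ := Finset.mem_image.1 this
    have hcd : d = c := by
      rw [← (hψ g hg c hc).2, ← (hψ g' hg' d hd).2, ← hdc]
    subst hcd
    exact hdc.symm
  · intro f hf
    obtain ⟨hf, hP⟩ := Finset.mem_filter.1 hf
    obtain ⟨hfN, hfc, hinj⟩ := mem_rainbowSets.1 hf
    have hex : ∀ c (_ : c ∈ P), ∃ v ∈ f, ψ v = c := fun c hc => by
      rw [← hP] at hc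
      exact Finset.mem_image.1 hc
    choose g hg hgc using hex
    refine ⟨g, ?_, ?_⟩
    · rw [Finset.mem_pi]
      exact fun c hc => Finset.mem_filter.2 ⟨hfN (hg c hc), hgc c hc⟩
    · apply Finset.eq_of_subset_of_card_le
      · intro v hv
        obtain ⟨c, -, rfl⟩ := Finset.mem_image.1 hv
        exact hg _ c.2
      · rw [Finset.card_image_of_injective, Finset.card_attach, hfc]
        intro c d hcd
        apply Subtype.ext
        rw [← hgc _ c.2, ← hgc _ d.2]
        exact congrArg ψ hcd

/-- The number of rainbow sets is an elementary symmetric sum of the sizes of the colour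
classes. -/
theorem card_rainbowSets {V C : Type*} [DecidableEq V] [DecidableEq C] {ψ : V → C}
    {N : Finset V} {Q : Finset C} (hQ : ∀ v ∈ N, ψ v ∈ Q) (s : ℕ) :
    (rainbowSets ψ N s).card
      = ∑ P ∈ Q.powersetCard s, ∏ c ∈ P, (N.filter (fun v => ψ v = c)).card := by
  rw [Finset.card_eq_sum_card_fiberwise (f := fun f => f.image ψ) (t := Q.powersetCard s)]
  · refine Finset.sum_congr rfl (fun P hP => ?_)
    obtain rfl := (Finset.mem_powersetCard.1 hP).2
    exact card_rainbowSets_image ψ N P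
  · intro f hf
    obtain ⟨hfN, hfc, hinj⟩ := mem_rainbowSets.1 hf
    refine Finset.mem_powersetCard.2 ⟨?_, ?_⟩
    · intro c hc
      obtain ⟨v, hv, rfl⟩ := Finset.mem_image.1 hc
      exact hQ v (hfN hv)
    · rw [Finset.card_image_of_injOn hinj, hfc]

theorem card_rainbowSets_le {V C : Type*} [DecidableEq V] [DecidableEq C] {ψ : V → C}
    {N : Finset V} {Q : Finset C} (hQ : ∀ v ∈ N, ψ v ∈ Q) (s : ℕ) :
    ((rainbowSets ψ N s).card : ℝ) ≤ (Q.card.choose s : ℝ) * (N.card / Q.card : ℝ) ^ s := by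
  rw [card_rainbowSets hQ, Finset.card_eq_sum_card_fiberwise (s := N) (t := Q) (f := ψ) hQ]
  push_cast
  exact sum_prod_powersetCard_le (fun c => Nat.cast_nonneg _) Q s

/-! ### From colorings of hypergraphs to rook complexes. -/

namespace RGraph

variable {V : Type*} {r : ℕ} {H : RGraph V r}

theorem isHom_complete_iff {k : ℕ} {ψ : V → Fin k} :
    H.IsHom (complete k r) ψ ↔ ∀ e ∈ H.edges, Set.InjOn ψ e := by
  refine forall₂_congr (fun e he => ?_)
  rw [← Finset.card_image_iff, H.card_of_mem e he]
  simp [complete]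

theorem mem_iterShadow [DecidableEq V] {j i : ℕ} (hj : i + j = r) {S : Finset V} :
    S ∈ H.iterShadow j ↔ S.card = i ∧ ∃ e ∈ H.edges, S ⊆ e := by
  rw [iterShadow, Finset.mem_shadow_iterate_iff_exists_mem_card_add]
  constructor
  · rintro ⟨e, he, hS, hc⟩
    rw [H.card_of_mem e he] at hc
    exact ⟨by omega, e, he, hS⟩
  · rintro ⟨hc, e, he, hS⟩
    exact ⟨e, he, hS, by rw [H.card_of_mem e he]; omega⟩

theorem mem_link [DecidableEq V] {S f : Finset V} (hS : S.card ≤ r) :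
    f ∈ H.link S ↔ f.card = r - S.card ∧ Disjoint S f ∧ S ∪ f ∈ H.edges := by
  rw [link, Finset.mem_filter, mem_iterShadow (i := r - S.card) (by omega)]
  constructor
  · rintro ⟨⟨hc, -⟩, he⟩
    refine ⟨hc, ?_, he⟩
    rw [← Finset.card_union_eq_card_add_card, H.card_of_mem _ he]
    omega
  · rintro ⟨hc, -, he⟩
    exact ⟨⟨hc, _, he, Finset.subset_union_right⟩, he⟩

/-- The vertices `v` such that `S` and `v` together lie in an edge. -/
def coneNbrs [Fintype V] [DecidableEq V] (H : RGraph V r) (S : Finset V) : Finset V :=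
  Finset.univ.filter (fun v => v ∉ S ∧ ∃ e ∈ H.edges, insert v S ⊆ e)

theorem mem_coneNbrs [Fintype V] [DecidableEq V] {S : Finset V} {v : V} :
    v ∈ H.coneNbrs S ↔ v ∉ S ∧ ∃ e ∈ H.edges, insert v S ⊆ e := by
  simp [coneNbrs]

/-- The link of `S` consists of rainbow subsets of its neighbourhood, which avoids the colors of
`S`; Maclaurin's inequality is applied to the remaining `k - |S|` color classes. -/
theorem degree_le [Fintype V] [DecidableEq V] {k : ℕ} {ψ : V → Fin k}
    (hψ : H.IsHom (complete k r) ψ) {S e : Finset V} (he : e ∈ H.edges) (hSe : S ⊆ e) :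
    (H.degree S : ℝ) ≤ ((k - S.card).choose (r - S.card) : ℝ) *
      ((H.coneNbrs S).card / ((k - S.card : ℕ) : ℝ)) ^ (r - S.card) := by
  rw [isHom_complete_iff] at hψ
  have hSr : S.card ≤ r := by rw [← H.card_of_mem e he]; exact Finset.card_le_card hSe
  have hQ : ∀ v ∈ H.coneNbrs S, ψ v ∈ Finset.univ \ S.image ψ := by
    intro v hv
    obtain ⟨hvS, d, hd, hsub⟩ := mem_coneNbrs.1 hv
    rw [Finset.mem_sdiff]
    refine ⟨Finset.mem_univ _, fun hc => ?_⟩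
    obtain ⟨x, hx, hxv⟩ := Finset.mem_image.1 hc
    exact hvS (hψ d hd (hsub (Finset.mem_insert_of_mem hx)) (hsub (Finset.mem_insert_self _ _))
      hxv ▸ hx)
  have hQc : (Finset.univ \ S.image ψ).card = k - S.card := by
    rw [Finset.card_sdiff_of_subset (Finset.subset_univ _), Finset.card_univ, Fintype.card_fin,
      Finset.card_image_of_injOn ((hψ e he).mono hSe)]
  have hsub : H.link S ⊆ rainbowSets ψ (H.coneNbrs S) (r - S.card) := by
    intro f hf
    obtain ⟨hfc, hdisj, hfe⟩ := (mem_link hSr).1 hf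
    refine mem_rainbowSets.2 ⟨fun v hv => mem_coneNbrs.2 ⟨Finset.disjoint_right.1 hdisj hv, _, hfe,
      Finset.insert_subset (Finset.mem_union_right _ hv) Finset.subset_union_left⟩, hfc,
      (hψ _ hfe).mono Finset.subset_union_right⟩
  have h1 := card_rainbowSets_le hQ (r - S.card)
  rw [hQc] at h1
  refine le_trans ?_ h1
  exact_mod_cast Finset.card_le_card hsub

/-- The complex of the images of edges under a pair of colorings. -/
def colorComplex [DecidableEq V] {k : ℕ} (H : RGraph V r) {ψ₁ ψ₂ : V → Fin k}
    (h₁ : H.IsHom (complete k r) ψ₁) (h₂ : H.IsHom (complete k r) ψ₂) :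
    RookComplex (Fin k) (Fin k) where
  rows := Finset.univ
  cols := Finset.univ
  faces := H.edges.biUnion (fun e => (e.image (fun v => (ψ₁ v, ψ₂ v))).powerset)
  down_closed := by
    intro S hS T hT
    simp only [Finset.mem_biUnion, Finset.mem_powerset] at hS ⊢
    obtain ⟨e, he, hSe⟩ := hS
    exact ⟨e, he, hT.trans hSe⟩
  subset_board := fun S _ x _ => by simp
  row_inj := by
    intro S hS x hx y hy hxy
    simp only [Finset.mem_biUnion, Finset.mem_powerset] at hS
    obtain ⟨e, he, hSe⟩ := hS
    obtain ⟨a, ha, rfl⟩ := Finset.mem_image.1 (hSe hx)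
    obtain ⟨b, hb, rfl⟩ := Finset.mem_image.1 (hSe hy)
    rw [isHom_complete_iff.1 h₁ e he ha hb hxy]
  col_inj := by
    intro S hS x hx y hy hxy
    simp only [Finset.mem_biUnion, Finset.mem_powerset] at hS
    obtain ⟨e, he, hSe⟩ := hS
    obtain ⟨a, ha, rfl⟩ := Finset.mem_image.1 (hSe hx)
    obtain ⟨b, hb, rfl⟩ := Finset.mem_image.1 (hSe hy)
    rw [isHom_complete_iff.1 h₂ e he ha hb hxy]

theorem mem_colorComplex_faces [DecidableEq V] {k : ℕ} {ψ₁ ψ₂ : V → Fin k}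
    {h₁ : H.IsHom (complete k r) ψ₁} {h₂ : H.IsHom (complete k r) ψ₂}
    {S : Finset (Fin k × Fin k)} :
    S ∈ (H.colorComplex h₁ h₂).faces ↔
      ∃ e ∈ H.edges, S ⊆ e.image (fun v => (ψ₁ v, ψ₂ v)) := by
  simp [colorComplex]

/-- If every `i`-set inside an edge has many neighbours, then two colorings agree on when
two vertices get the same color. -/
theorem eq_of_coneNbrs_large [Fintype V] [DecidableEq V] {k i : ℕ} (hi : 1 ≤ i) (hir : i < r)
    (hrk : r ≤ k) (hiso : H.NoIsolated)
    (hN : ∀ S : Finset V, S.card = i → (∃ e ∈ H.edges, S ⊆ e) →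
      (3 * k - 3 * i - 2) * (Fintype.card V : ℝ) < (3 * k - 2) * (H.coneNbrs S).card ∧
      ((k : ℝ) - i) * Fintype.card V < (k + 2) * (H.coneNbrs S).card)
    {ψ₁ ψ₂ : V → Fin k} (h₁ : H.IsHom (complete k r) ψ₁) (h₂ : H.IsHom (complete k r) ψ₂)
    {x y : V} (hxy : ψ₁ x = ψ₁ y) : ψ₂ x = ψ₂ y := by
  set φ : V → Fin k × Fin k := fun v => (ψ₁ v, ψ₂ v) with hφ
  set w : Fin k × Fin k → ℝ := fun c => ((Finset.univ.filter (fun v => φ v = c)).card : ℝ) with hw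
  have hφe : ∀ e ∈ H.edges, Set.InjOn φ e := fun e he a ha b hb hab =>
    isHom_complete_iff.1 h₁ e he ha hb (Prod.ext_iff.1 hab).1
  have hsum : ∀ X : Finset (Fin k × Fin k),
      ∑ c ∈ X, w c = ((Finset.univ.filter (fun v => φ v ∈ X)).card : ℝ) := by
    intro X
    rw [hw, Finset.card_eq_sum_card_fiberwise (f := φ) (t := X) (by intro v hv; simpa using hv)]
    push_cast
    refine Finset.sum_congr rfl (fun c hc => ?_)
    congr 2
    ext v
    simp only [Finset.mem_filter, Finset.mem_univ, true_and]
    constructor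
    · rintro rfl; exact ⟨hc, rfl⟩
    · exact fun h => h.2
  have hk : (2 : ℝ) ≤ k := by exact_mod_cast (by omega : 2 ≤ k)
  have hki : (i : ℝ) + 1 ≤ k := by exact_mod_cast (by omega : i + 1 ≤ k)
  set n' := ∑ c ∈ (H.colorComplex h₁ h₂).nbrs ∅, w c with hn'
  have hn'V : n' ≤ Fintype.card V := by
    rw [hn', hsum]
    exact_mod_cast Finset.card_le_univ _
  have hmul : (3 * k - 2) * (n' / (3 * k - 2)) = n' := by
    field_simp [show (3 * k - 2 : ℝ) ≠ 0 by linarith]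
  have hdense : ∀ S ∈ (H.colorComplex h₁ h₂).faces, S.card = i →
      (3 * k - 3 * i - 2) * (Fintype.card V : ℝ)
        < (3 * k - 2) * ∑ c ∈ (H.colorComplex h₁ h₂).nbrs S, w c ∧
      ((k : ℝ) - i) * Fintype.card V
        < (k + 2) * ∑ c ∈ (H.colorComplex h₁ h₂).nbrs S, w c := by
    intro S hS hSi
    obtain ⟨e, he, hSe⟩ := mem_colorComplex_faces.1 hS
    have himg : (e.filter (fun v => φ v ∈ S)).image φ = S := by
      ext c
      simp only [Finset.mem_image, Finset.mem_filter]
      constructor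
      · rintro ⟨v, ⟨-, hv⟩, rfl⟩; exact hv
      · intro hc
        obtain ⟨v, hv, rfl⟩ := Finset.mem_image.1 (hSe hc)
        exact ⟨v, ⟨hv, hc⟩, rfl⟩
    have hTe : e.filter (fun v => φ v ∈ S) ⊆ e := Finset.filter_subset _ _
    have hTc : (e.filter (fun v => φ v ∈ S)).card = i := by
      rw [← hSi, ← himg, Finset.card_image_of_injOn ((hφe e he).mono hTe), himg]
    set T := e.filter (fun v => φ v ∈ S)
    -- The face `S` lifts to an `i`-set `T` inside one edge, and every neighbour of `T` lies in a
    -- cell extending `S`.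
    have hle : ((H.coneNbrs T).card : ℝ) ≤ ∑ c ∈ (H.colorComplex h₁ h₂).nbrs S, w c := by
      rw [hsum]
      refine Nat.cast_le.2 (Finset.card_le_card (fun v hv => ?_))
      obtain ⟨hvT, d, hd, hsub⟩ := mem_coneNbrs.1 hv
      refine Finset.mem_filter.2 ⟨Finset.mem_univ _, RookComplex.mem_nbrs.2 ⟨fun hvS => ?_, ?_⟩⟩
      · rw [← himg] at hvS
        obtain ⟨t, ht, htv⟩ := Finset.mem_image.1 hvS
        exact hvT (hφe d hd (hsub (Finset.mem_insert_of_mem ht))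
          (hsub (Finset.mem_insert_self _ _)) htv ▸ ht)
      · refine mem_colorComplex_faces.2 ⟨d, hd, ?_⟩
        rw [← himg, ← Finset.image_insert]
        exact Finset.image_subset_image hsub
    obtain ⟨b1, b2⟩ := hN T hTc ⟨e, he, hTe⟩
    exact ⟨b1.trans_le (mul_le_mul_of_nonneg_left hle (by linarith)),
      b2.trans_le (mul_le_mul_of_nonneg_left hle (by linarith))⟩
  have hD : (H.colorComplex h₁ h₂).IsDense w (n' / (3 * k - 2)) k i := by
    refine ⟨fun c => Nat.cast_nonneg _, hi, by omega, by simp [colorComplex],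
      by simp [colorComplex], ?_, hmul.symm, ?_, ?_⟩
    · intro S hS hSi
      obtain ⟨e, he, hSe⟩ := mem_colorComplex_faces.1 hS
      obtain ⟨c, hc, hcS⟩ := Finset.exists_mem_notMem_of_card_lt_card (s := S) (t := e.image φ)
        (by rw [Finset.card_image_of_injOn (hφe e he), H.card_of_mem e he]; omega)
      exact ⟨c, RookComplex.mem_nbrs.2 ⟨hcS, mem_colorComplex_faces.2
        ⟨e, he, Finset.insert_subset hc hSe⟩⟩⟩
    · intro S hS hSi
      have h1 := (hdense S hS hSi).1
      refine lt_of_mul_lt_mul_left (a := (3 * k - 2 : ℝ)) ?_ (by linarith)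
      have h2 := mul_le_mul_of_nonneg_left hn'V (by linarith : (0 : ℝ) ≤ 3 * k - 3 * i - 2)
      linear_combination h1 + h2 + (3 * k - 3 * i - 2) * hmul
    · intro S hS hSi
      have h1 := (hdense S hS hSi).2
      have h2 := mul_le_mul_of_nonneg_left hn'V (by linarith : (0 : ℝ) ≤ k - i)
      rw [hmul]
      linarith
  have hvert : ∀ v : V, φ v ∈ (H.colorComplex h₁ h₂).nbrs ∅ := by
    intro v
    obtain ⟨e, he, hv⟩ := hiso v
    rw [RookComplex.mem_verts, mem_colorComplex_faces]
    exact ⟨e, he, Finset.singleton_subset_iff.2 (Finset.mem_image_of_mem φ hv)⟩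
  have := hD.nonattacking _ (hvert x) _ (hvert y) (Or.inl hxy)
  exact (Prod.ext_iff.1 this).2

theorem isAut_complete {k : ℕ} (η : Equiv.Perm (Fin k)) : (complete k r).IsAut η :=
  ⟨η.surjective, isHom_complete_iff.2 (fun _ _ => η.injective.injOn)⟩

/-- Equal color classes give a bijection between the colors used, which extends to the unused ones
because the color set is finite. -/
theorem exists_perm_comp_eq {k : ℕ} {ψ₁ ψ₂ : V → Fin k} (h : ∀ x y, ψ₁ x = ψ₁ y ↔ ψ₂ x = ψ₂ y) :
    ∃ η : Equiv.Perm (Fin k), η ∘ ψ₁ = ψ₂ := by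
  classical
  let g : {c // c ∈ Set.range ψ₁} → {c // c ∈ Set.range ψ₂} :=
    fun c => ⟨ψ₂ c.2.choose, _, rfl⟩
  have hg : ∀ v, g ⟨ψ₁ v, v, rfl⟩ = ⟨ψ₂ v, v, rfl⟩ := fun v => by
    apply Subtype.ext
    exact (h _ _).1 (Exists.choose_spec (⟨v, rfl⟩ : ∃ y, ψ₁ y = ψ₁ v))
  have hbij : Function.Bijective g := by
    constructor
    · rintro ⟨_, v, rfl⟩ ⟨_, v', rfl⟩ hvv
      rw [hg, hg] at hvv
      exact Subtype.ext ((h _ _).2 (Subtype.ext_iff.1 hvv))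
    · rintro ⟨_, v, rfl⟩
      exact ⟨_, hg v⟩
  refine ⟨(Equiv.ofBijective g hbij).extendSubtype, funext fun v => ?_⟩
  rw [Function.comp_apply, Equiv.extendSubtype_apply_of_mem _ _ ⟨v, rfl⟩]
  exact Subtype.ext_iff.1 (hg v)

theorem uniquelyColorable_of_posMinDegree [Fintype V] [DecidableEq V] {k i : ℕ} (hi : 1 ≤ i)
    (hir : i < r) (hrk : r ≤ k) (hcol : H.Colorable k) (hiso : H.NoIsolated)
    (hdeg : ((k - i).choose (r - i) : ℝ) *
      (1 / ((k : ℝ) - i) *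
        max (((k : ℝ) - i) / ((k : ℝ) + 2))
          ((3 * (k : ℝ) - 3 * i - 2) / (3 * (k : ℝ) - 2))) ^ (r - i) *
        (Fintype.card V : ℝ) ^ (r - i) < (H.posMinDegree i : ℝ)) :
    H.UniquelyColorable k := by
  have hk : (2 : ℝ) ≤ k := by exact_mod_cast (by omega : 2 ≤ k)
  have hki : (i : ℝ) + 1 ≤ k := by exact_mod_cast (by omega : i + 1 ≤ k)
  set M := max (((k : ℝ) - i) / ((k : ℝ) + 2))
          ((3 * (k : ℝ) - 3 * i - 2) / (3 * (k : ℝ) - 2)) with hM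
  obtain ⟨ψ₀, hψ₀⟩ := hcol
  have hN : ∀ S : Finset V, S.card = i → (∃ e ∈ H.edges, S ⊆ e) →
      M * (Fintype.card V : ℝ) < (H.coneNbrs S).card := by
    rintro S hSi ⟨e, he, hSe⟩
    have h1 := degree_le hψ₀ he hSe
    rw [hSi] at h1
    have h2 : H.posMinDegree i ≤ H.degree S :=
      Nat.sInf_le ⟨S, (mem_iterShadow (i := i) (by omega)).2 ⟨hSi, e, he, hSe⟩, rfl⟩
    have h3 := (hdeg.trans_le (Nat.cast_le.2 h2)).trans_le h1
    rw [mul_assoc, ← mul_pow] at h3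
    -- The threshold has the same shape as the Maclaurin bound, so cancelling the binomial
    -- coefficient and taking roots leaves a linear bound on the neighbourhood.
    have h4 := lt_of_mul_lt_mul_left h3 (Nat.cast_nonneg _)
    have h5 := lt_of_pow_lt_pow_left₀ _ (div_nonneg (Nat.cast_nonneg _) (Nat.cast_nonneg _)) h4
    rw [Nat.cast_sub (by omega), lt_div_iff₀ (by linarith)] at h5
    have h6 : (k : ℝ) - i ≠ 0 := by linarith
    calc M * (Fintype.card V : ℝ) = 1 / ((k : ℝ) - i) * M * Fintype.card V * (k - i) := by
          field_simp
      _ < _ := h5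
  have hN' : ∀ S : Finset V, S.card = i → (∃ e ∈ H.edges, S ⊆ e) →
      (3 * k - 3 * i - 2) * (Fintype.card V : ℝ) < (3 * k - 2) * (H.coneNbrs S).card ∧
      ((k : ℝ) - i) * Fintype.card V < (k + 2) * (H.coneNbrs S).card := by
    intro S hSi hSe
    have h1 := hN S hSi hSe
    constructor
    · have h2 := (mul_le_mul_of_nonneg_right (le_max_right _ _) (Nat.cast_nonneg _)).trans_lt h1
      rw [div_mul_eq_mul_div, div_lt_iff₀ (by linarith)] at h2
      linarith
    · have h2 := (mul_le_mul_of_nonneg_right (le_max_left _ _) (Nat.cast_nonneg _)).trans_lt h1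
      rw [div_mul_eq_mul_div, div_lt_iff₀ (by linarith)] at h2
      linarith
  refine ⟨⟨ψ₀, hψ₀⟩, fun ψ₁ ψ₂ h₁ h₂ => ?_⟩
  obtain ⟨η, hη⟩ := exists_perm_comp_eq (ψ₁ := ψ₁) (ψ₂ := ψ₂) (fun x y =>
    ⟨eq_of_coneNbrs_large hi hir hrk hiso hN' h₁ h₂, eq_of_coneNbrs_large hi hir hrk hiso hN' h₂ h₁⟩)
  exact ⟨η, isAut_complete η, hη⟩

end RGraph

/-! ### The extremal construction. -/

/-- The indices of the `k` parts inside the side `s` of the construction. -/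
def sideParts (k : ℕ) (s : Fin 2) : Finset (ConstrPart k) :=
  Finset.univ.disjSum (Finset.univ ×ˢ {s})

theorem card_sideParts {k : ℕ} (hk : 2 ≤ k) (s : Fin 2) : (sideParts k s).card = k := by
  simp [sideParts, Finset.card_disjSum]
  omega

theorem inr_mem_sideParts {k : ℕ} {s c t : Fin 2} :
    (Sum.inr (c, t) : ConstrPart k) ∈ sideParts k s ↔ t = s := by
  simp [sideParts, eq_comm]

theorem inl_mem_sideParts {k : ℕ} {s : Fin 2} {j : Fin (k - 2)} :
    (Sum.inl j : ConstrPart k) ∈ sideParts k s := by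
  simp [sideParts]

theorem mem_constrSide {k m : ℕ} {s : Fin 2} {v : ConstrVertex k m} :
    v ∈ constrSide k m s ↔ v.1 ∈ sideParts k s := by
  obtain ⟨p | ⟨c, t⟩, x⟩ := v
  · simp [constrSide, inl_mem_sideParts]
  · rw [inr_mem_sideParts]
    simp only [constrSide, Finset.mem_filter, Finset.mem_univ, true_and, Sum.inr.injEq,
      Prod.mk.injEq]
    exact ⟨fun h => h c t ⟨rfl, rfl⟩, fun h _ _ h' => h'.2 ▸ h⟩

theorem mem_constrGraph_edges {k r m : ℕ} {e : Finset (ConstrVertex k m)} :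
    e ∈ (constrGraph k r m).edges ↔ e.card = r ∧
      ∃ s : Fin 2, (∀ v ∈ e, v.1 ∈ sideParts k s) ∧ Set.InjOn Prod.fst (e : Set (ConstrVertex k m)) := by
  simp only [constrGraph, Finset.mem_filter, Finset.mem_powersetCard, Finset.subset_univ, true_and]
  refine and_congr_right fun _ => exists_congr fun s => and_congr ?_ ?_
  · exact forall₂_congr fun v _ => mem_constrSide
  · constructor
    · intro h x hx y hy hxy
      exact Finset.card_le_one.1 (h x.1) x (by simpa [constrPartSet] using hx)
        y (by simpa [constrPartSet] using ⟨hy, hxy.symm⟩)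
    · intro h p
      refine Finset.card_le_one.2 (fun x hx y hy => ?_)
      simp only [constrPartSet, Finset.mem_inter, Finset.mem_filter, Finset.mem_univ,
        true_and] at hx hy
      exact h hx.1 hy.1 (hx.2.trans hy.2.symm)

theorem product_singleton_mem_constrGraph_edges {k r m : ℕ} {s : Fin 2}
    {R : Finset (ConstrPart k)} (hR : R ⊆ sideParts k s) (hc : R.card = r) (x : Fin m) :
    R ×ˢ {x} ∈ (constrGraph k r m).edges := by
  refine mem_constrGraph_edges.2 ⟨by simp [hc], s, fun v hv => hR (Finset.mem_product.1 hv).1, ?_⟩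
  intro v hv v' hv' h
  rw [Finset.mem_coe, Finset.mem_product, Finset.mem_singleton] at hv hv'
  exact Prod.ext h (hv.2.trans hv'.2.symm)

/-- The coloring in which the part with index `(c, s)` receives the color of index `f c s` among
the last two. -/
def constrColor (k : ℕ) (hk : 2 ≤ k) (f : Fin 2 → Fin 2 → Fin 2) : ConstrPart k → Fin k
  | Sum.inl j => ⟨j, by omega⟩
  | Sum.inr (c, s) => ⟨k - 2 + f c s, by omega⟩

theorem constrColor_injOn {k : ℕ} (hk : 2 ≤ k) {f : Fin 2 → Fin 2 → Fin 2} {s : Fin 2}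
    (hf : Function.Injective (fun c => f c s)) :
    Set.InjOn (constrColor k hk f) (sideParts k s : Set (ConstrPart k)) := by
  rintro (j | ⟨c, t⟩) hx (j' | ⟨c', t'⟩) hy h
  · simpa [constrColor, Fin.ext_iff] using h
  · simp only [constrColor, Fin.mk.injEq] at h
    omega
  · simp only [constrColor, Fin.mk.injEq] at h
    omega
  · obtain rfl := inr_mem_sideParts.1 hx
    obtain rfl := inr_mem_sideParts.1 hy
    simp only [constrColor, Fin.mk.injEq] at h
    have : c = c' := hf (Fin.ext (by simpa using h))
    rw [this]

theorem constrColor_isHom {k r m : ℕ} (hk : 2 ≤ k) {f : Fin 2 → Fin 2 → Fin 2}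
    (hf : ∀ s, Function.Injective (fun c => f c s)) :
    (constrGraph k r m).IsHom (RGraph.complete k r) (fun v => constrColor k hk f v.1) := by
  refine RGraph.isHom_complete_iff.2 (fun e he x hx y hy h => ?_)
  obtain ⟨-, s, hs, hinj⟩ := mem_constrGraph_edges.1 he
  exact hinj hx hy (constrColor_injOn hk (hf s) (hs x hx) (hs y hy) h)

theorem constrGraph_colorable {k r m : ℕ} (hk : 2 ≤ k) : (constrGraph k r m).Colorable k :=
  ⟨_, constrColor_isHom hk (f := fun c _ => c) (fun _ => Function.injective_id)⟩

theorem constrGraph_not_uniquelyColorable {k r m : ℕ} (hk : 2 ≤ k) (hm : 1 ≤ m) :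
    ¬ (constrGraph k r m).UniquelyColorable k := by
  rintro ⟨-, h⟩
  -- The second coloring swaps the last two colors on side `1` only (addition in `Fin 2`). It
  -- separates the parts `(0, 0)` and `(0, 1)`, which the first colors alike.
  obtain ⟨η, -, hη⟩ := h _ _
    (constrColor_isHom hk (f := fun c _ => c) (fun _ => Function.injective_id))
    (constrColor_isHom hk (f := fun c s => c + s) (fun s => add_left_injective s))
  have h0 := congrFun hη (Sum.inr (0, 0), ⟨0, hm⟩)
  have h1 := congrFun hη (Sum.inr (0, 1), ⟨0, hm⟩)
  simp only [Function.comp_apply, constrColor] at h0 h1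
  rw [h0] at h1
  simp at h1

theorem constrGraph_noIsolated {k r m : ℕ} (hk : 2 ≤ k) (hr : 1 ≤ r) (hrk : r ≤ k) :
    (constrGraph k r m).NoIsolated := by
  rintro ⟨p, x⟩
  obtain ⟨s, hs⟩ : ∃ s, p ∈ sideParts k s := by
    rcases p with j | ⟨c, t⟩
    · exact ⟨0, inl_mem_sideParts⟩
    · exact ⟨t, inr_mem_sideParts.2 rfl⟩
  obtain ⟨R, hpR, hR, hc⟩ := Finset.exists_subsuperset_card_eq
    (Finset.singleton_subset_iff.2 hs) (by simpa using hr) (by rwa [card_sideParts hk])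
  exact ⟨_, product_singleton_mem_constrGraph_edges hR hc x,
    by simpa using hpR⟩

theorem card_constrVertex {k m : ℕ} (hk : 2 ≤ k) : Fintype.card (ConstrVertex k m) = (k + 2) * m := by
  simp only [Fintype.card_prod, Fintype.card_sum, Fintype.card_fin]
  congr 1
  omega

theorem card_rainbowSets_product {α : Type*} [DecidableEq α] (Q : Finset α) (m s : ℕ) :
    (rainbowSets Prod.fst (Q ×ˢ (Finset.univ : Finset (Fin m))) s).card
      = Q.card.choose s * m ^ s := by
  rw [card_rainbowSets (Q := Q) (fun v hv => (Finset.mem_product.1 hv).1)]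
  have hcard : ∀ c ∈ Q, ((Q ×ˢ (Finset.univ : Finset (Fin m))).filter
      (fun v => v.1 = c)).card = m := by
    intro c hc
    have : (Q ×ˢ (Finset.univ : Finset (Fin m))).filter (fun v => v.1 = c)
        = {c} ×ˢ Finset.univ := by
      ext v
      simp only [Finset.mem_filter, Finset.mem_product, Finset.mem_univ, and_true,
        Finset.mem_singleton]
      exact ⟨fun h => h.2, fun h => ⟨h ▸ hc, h⟩⟩
    rw [this]
    simp
  have : ∀ P ∈ Q.powersetCard s, ∏ c ∈ P, ((Q ×ˢ (Finset.univ : Finset (Fin m))).filter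
      (fun v => v.1 = c)).card = m ^ s := by
    intro P hP
    rw [Finset.mem_powersetCard] at hP
    rw [Finset.prod_congr rfl (fun c hc => hcard c (hP.1 hc)), Finset.prod_const, hP.2]
  rw [Finset.sum_congr rfl this, Finset.sum_const, Finset.card_powersetCard, smul_eq_mul]

section

variable {k r m : ℕ} {s : Fin 2} {S : Finset (ConstrVertex k m)}

theorem rainbowSets_subset_link (hSr : S.card ≤ r) (hS : ∀ v ∈ S, v.1 ∈ sideParts k s)
    (hinj : Set.InjOn Prod.fst (S : Set (ConstrVertex k m))) :
    rainbowSets Prod.fst ((sideParts k s \ S.image Prod.fst) ×ˢ Finset.univ) (r - S.card)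
      ⊆ (constrGraph k r m).link S := by
  intro f hf
  obtain ⟨hfN, hfc, hfi⟩ := mem_rainbowSets.1 hf
  have hfS : ∀ v ∈ f, v.1 ∈ sideParts k s ∧ ∀ x ∈ S, x.1 ≠ v.1 := fun v hv => by
    have := (Finset.mem_product.1 (hfN hv)).1
    rw [Finset.mem_sdiff] at this
    exact ⟨this.1, fun x hx hxv => this.2 (Finset.mem_image.2 ⟨x, hx, hxv⟩)⟩
  have hdisj : Disjoint S f := Finset.disjoint_left.2 (fun x hx hxf => (hfS x hxf).2 x hx rfl)
  refine (RGraph.mem_link hSr).2 ⟨hfc, hdisj, mem_constrGraph_edges.2 ⟨?_, s, ?_, ?_⟩⟩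
  · rw [Finset.card_union_of_disjoint hdisj, hfc]; omega
  · intro v hv
    exact (Finset.mem_union.1 hv).elim (hS v) (fun h => (hfS v h).1)
  · intro x hx y hy hxy
    rcases Finset.mem_union.1 hx with hx | hx <;> rcases Finset.mem_union.1 hy with hy | hy
    · exact hinj hx hy hxy
    · exact absurd hxy ((hfS y hy).2 x hx)
    · exact absurd hxy.symm ((hfS x hx).2 y hy)
    · exact hfi hx hy hxy

/-- A vertex in a split part determines the side of every edge through it. Without one, the link
could draw on both sides. -/
theorem link_subset_rainbowSets (hSr : S.card ≤ r) {v : ConstrVertex k m} (hv : v ∈ S)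
    {c : Fin 2} (hvc : v.1 = Sum.inr (c, s)) :
    (constrGraph k r m).link S ⊆
      rainbowSets Prod.fst ((sideParts k s \ S.image Prod.fst) ×ˢ Finset.univ) (r - S.card) := by
  intro f hf
  obtain ⟨hfc, hdisj, hfe⟩ := (RGraph.mem_link hSr).1 hf
  obtain ⟨-, t, ht, hinj⟩ := mem_constrGraph_edges.1 hfe
  have hts := ht v (Finset.mem_union_left _ hv)
  rw [hvc, inr_mem_sideParts] at hts
  subst hts
  refine mem_rainbowSets.2 ⟨fun x hx => ?_, hfc, hinj.mono (by simp)⟩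
  refine Finset.mem_product.2 ⟨Finset.mem_sdiff.2 ⟨ht x (Finset.mem_union_right _ hx), ?_⟩,
    Finset.mem_univ _⟩
  intro hxS
  obtain ⟨y, hy, hyx⟩ := Finset.mem_image.1 hxS
  have hyx' := hinj (Finset.mem_coe.2 (Finset.mem_union_left _ hy))
    (Finset.mem_coe.2 (Finset.mem_union_right _ hx)) hyx
  exact Finset.disjoint_left.1 hdisj hy (hyx' ▸ hx)

theorem card_rainbowSets_sideParts (hk : 2 ≤ k) (hS : ∀ v ∈ S, v.1 ∈ sideParts k s)
    (hinj : Set.InjOn Prod.fst (S : Set (ConstrVertex k m))) :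
    (rainbowSets Prod.fst ((sideParts k s \ S.image Prod.fst) ×ˢ
      (Finset.univ : Finset (Fin m))) (r - S.card)).card
      = (k - S.card).choose (r - S.card) * m ^ (r - S.card) := by
  have hsub : S.image Prod.fst ⊆ sideParts k s := by
    intro p hp
    obtain ⟨v, hv, rfl⟩ := Finset.mem_image.1 hp
    exact hS v hv
  rw [card_rainbowSets_product, Finset.card_sdiff_of_subset hsub, card_sideParts hk,
    Finset.card_image_of_injOn hinj]

end

/-- Every `i`-set inside an edge is completed by all rainbow sets on one side; an `i`-set meeting a
split part has no other completions and attains the minimum. -/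
theorem constrGraph_posMinDegree {k r i m : ℕ} (hi : 1 ≤ i) (hir : i < r) (hrk : r ≤ k)
    (hm : 1 ≤ m) :
    (constrGraph k r m).posMinDegree i = (k - i).choose (r - i) * m ^ (r - i) := by
  have hk : 2 ≤ k := by omega
  obtain ⟨R, hpR, hR, hRc⟩ := Finset.exists_subsuperset_card_eq
    (Finset.singleton_subset_iff.2 (inr_mem_sideParts (k := k) (c := 0).2 (rfl : (0 : Fin 2) = 0)))
    (by simpa using hi) (by rw [card_sideParts hk]; omega)
  obtain ⟨R', hRR', hR', hRc'⟩ := Finset.exists_subsuperset_card_eq hR (n := r)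
    (by omega) (by rwa [card_sideParts hk])
  have hSc : (R ×ˢ {(⟨0, hm⟩ : Fin m)}).card = i := by simp [hRc]
  have he := product_singleton_mem_constrGraph_edges hR' hRc' ⟨0, hm⟩
  have hSe : R ×ˢ {(⟨0, hm⟩ : Fin m)} ⊆ R' ×ˢ {(⟨0, hm⟩ : Fin m)} :=
    Finset.product_subset_product hRR' subset_rfl
  have hmem : R ×ˢ {(⟨0, hm⟩ : Fin m)} ∈ (constrGraph k r m).iterShadow (r - i) :=
    (RGraph.mem_iterShadow (i := i) (by omega)).2 ⟨hSc, _, he, hSe⟩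
  unfold RGraph.posMinDegree
  apply le_antisymm
  · refine (Nat.sInf_le (Exists.intro _ ⟨hmem, rfl⟩)).trans ?_
    have hsub := link_subset_rainbowSets (k := k) (r := r) (S := R ×ˢ {(⟨0, hm⟩ : Fin m)})
      (s := 0) (c := 0) (v := (Sum.inr (0, 0), ⟨0, hm⟩)) (by omega)
      (by simpa using hpR) rfl
    have h1 := Finset.card_le_card hsub
    obtain ⟨-, s, -, hinj⟩ := mem_constrGraph_edges.1 he
    rw [card_rainbowSets_sideParts hk (fun v hv => hR (Finset.mem_product.1 hv).1)
      (hinj.mono (by exact_mod_cast hSe)), hSc] at h1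
    exact h1
  · refine le_csInf ⟨_, ⟨_, hmem, rfl⟩⟩ ?_
    rintro d ⟨S, hS, rfl⟩
    obtain ⟨hSi, e, he, hSe⟩ := (RGraph.mem_iterShadow (i := i) (by omega)).1 hS
    obtain ⟨-, s, hs, hinj⟩ := mem_constrGraph_edges.1 he
    have hS' : ∀ v ∈ S, v.1 ∈ sideParts k s := fun v hv => hs v (hSe hv)
    have hinj' := hinj.mono (Finset.coe_subset.2 hSe)
    have h1 := Finset.card_le_card
      (rainbowSets_subset_link (r := r) (by omega) hS' hinj')
    rw [card_rainbowSets_sideParts hk hS' hinj', hSi] at h1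
    exact h1

theorem constrGraph_posMinDegree_eq {k r i m : ℕ} (hi : 1 ≤ i) (hir : i < r) (hrk : r ≤ k)
    (hm : 1 ≤ m) :
    ((constrGraph k r m).posMinDegree i : ℝ) =
        ((k - i).choose (r - i) : ℝ) * (1 / ((k : ℝ) + 2)) ^ (r - i) *
          (Fintype.card (ConstrVertex k m) : ℝ) ^ (r - i) := by
  rw [constrGraph_posMinDegree hi hir hrk hm, card_constrVertex (by omega), mul_assoc, ← mul_pow]
  have : (1 / ((k : ℝ) + 2)) * (((k + 2) * m : ℕ) : ℝ) = m := by
    push_cast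
    field_simp
  rw [this]
  push_cast
  rfl

/-! ### The threshold and its value. -/

theorem mem_colorThresholds_lower {k r i : ℕ} (hi : 1 ≤ i) (hir : i < r) (hrk : r ≤ k) {c : ℝ}
    (hc : c ∈ colorThresholds k r i) :
    ((k - i).choose (r - i) : ℝ) * (1 / ((k : ℝ) + 2)) ^ (r - i) ≤ c := by
  have hk : 2 ≤ k := by omega
  by_contra hlt
  push Not at hlt
  have hcard := card_constrVertex (m := 1) hk
  refine constrGraph_not_uniquelyColorable hk le_rfl (hc (ConstrVertex k 1) (constrGraph k r 1)
    (by omega) (constrGraph_colorable hk) (constrGraph_noIsolated hk (by omega) hrk) ?_)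
  rw [constrGraph_posMinDegree_eq hi hir hrk le_rfl]
  refine mul_lt_mul_of_pos_right hlt (pow_pos ?_ _)
  exact_mod_cast (by omega : 0 < Fintype.card (ConstrVertex k 1))

/-- The infimum of the thresholds is attained. -/
theorem colorPhi_mem {k r i : ℕ} (hk : 1 ≤ k) (hne : (colorThresholds k r i).Nonempty) :
    colorPhi k r i ∈ colorThresholds k r i := by
  intro V _ _ H hV hcol hiso hdeg
  have hpos : (0 : ℝ) < (Fintype.card V : ℝ) ^ (r - i) :=
    pow_pos (by exact_mod_cast (by omega : 0 < Fintype.card V)) _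
  -- The degree condition is strict, so a normalized degree above the infimum already exceeds some
  -- threshold.
  rw [← lt_div_iff₀ hpos] at hdeg
  obtain ⟨c, hc, hlt⟩ := exists_lt_of_csInf_lt hne hdeg
  exact hc V H hV hcol hiso ((lt_div_iff₀ hpos).1 hlt)

theorem corollary1p4 (k r i : ℕ) (hi : 1 ≤ i) (hir : i < r) (hrk : r ≤ k) :
    IsLeast (colorThresholds k r i) (colorPhi k r i) ∧
    colorPhi k r i ≤ ((k - i).choose (r - i) : ℝ) *
      (1 / ((k : ℝ) - i) *
        max (((k : ℝ) - i) / ((k : ℝ) + 2))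
          ((3 * (k : ℝ) - 3 * i - 2) / (3 * (k : ℝ) - 2))) ^ (r - i) ∧
    ((k : ℝ) ≤ (4 * (i : ℝ) + 2) / 3 →
      colorPhi k r i = ((k - i).choose (r - i) : ℝ) * (1 / ((k : ℝ) + 2)) ^ (r - i)) ∧
    (∀ m : ℕ, 1 ≤ m →
      Fintype.card (ConstrVertex k m) = (k + 2) * m ∧
      (constrGraph k r m).Colorable k ∧
      (constrGraph k r m).NoIsolated ∧
      ¬ (constrGraph k r m).UniquelyColorable k ∧
      ((constrGraph k r m).posMinDegree i : ℝ) =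
        ((k - i).choose (r - i) : ℝ) * (1 / ((k : ℝ) + 2)) ^ (r - i) *
          (Fintype.card (ConstrVertex k m) : ℝ) ^ (r - i)) := by
  have hk : 2 ≤ k := by omega
  have hmem : ((k - i).choose (r - i) : ℝ) *
      (1 / ((k : ℝ) - i) *
        max (((k : ℝ) - i) / ((k : ℝ) + 2))
          ((3 * (k : ℝ) - 3 * i - 2) / (3 * (k : ℝ) - 2))) ^ (r - i)
      ∈ colorThresholds k r i := fun V _ _ H _ hcol hiso hdeg =>
    RGraph.uniquelyColorable_of_posMinDegree hi hir hrk hcol hiso hdeg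
  have hlow : ∀ c ∈ colorThresholds k r i,
      ((k - i).choose (r - i) : ℝ) * (1 / ((k : ℝ) + 2)) ^ (r - i) ≤ c :=
    fun c hc => mem_colorThresholds_lower hi hir hrk hc
  have hbdd : BddBelow (colorThresholds k r i) := ⟨_, hlow⟩
  have hmin := colorPhi_mem (by omega : 1 ≤ k) ⟨_, hmem⟩
  have hle := csInf_le hbdd hmem
  refine ⟨⟨hmin, fun c hc => csInf_le hbdd hc⟩, hle, fun hki => ?_, fun m hm =>
    ⟨card_constrVertex hk, constrGraph_colorable hk, constrGraph_noIsolated hk (by omega) hrk,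
      constrGraph_not_uniquelyColorable hk hm, constrGraph_posMinDegree_eq hi hir hrk hm⟩⟩
  refine le_antisymm (hle.trans (le_of_eq ?_)) (hlow _ hmin)
  have hk' : (2 : ℝ) ≤ k := by exact_mod_cast hk
  have hik : (i : ℝ) + 1 ≤ k := by exact_mod_cast (by omega : i + 1 ≤ k)
  -- After cross-multiplication, the first term of the maximum dominates exactly when `6k ≤ 8i + 4`.
  rw [max_eq_left]
  · congr 2
    have : (k : ℝ) - i ≠ 0 := by linarith
    field_simp
  · rw [div_le_div_iff₀ (by linarith) (by linarith)]
    linarith
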